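/- Setting. Let $(X,\omega)$ be a symplectic manifold of real dimension $2n$ and $\pi:X\to B$ a Lagrangian torus bundle with a semi-flat atlas: $B$ is covered by open sets $U$ with action coordinates $r=(r_1,\dots,r_n)$, and $\pi^{-1}(U)\cong\{(r,\theta):r\in r(U),\ \theta\in\mathbb R^n/\mathbb Z^n\}$ with $\omega=\sum_i d\theta_i\wedge dr_i$, such that all coordinate changes are locally of the form $r'=Ar+b$, $\theta'=A^{-T}\theta+c$ with $A\in SL(n,\mathbb Z)$ and $b,c\in\mathbb R^n$ constant. Let $\check\pi:\check X\to B$ be the mirror, that is, the dual torus bundle of flat $U(1)$-connections on the fibres of $\pi$: over $U$ it has coordinates $(r,\check\theta)$, $\check\theta\in\mathbb R^n/\mathbb Z^n$, with $\check\theta'=A\check\theta$ under the above coordinate changes, and it is a complex manifold with local holomorphic coordinates $z_j=\check\theta_j+\mathbf i r_j$. Let $\Omega_B^*(X,\mathbb C)$ be the space of smooth complex-valued forms on $X$ that are locally $\sum a_{IJ}(r)\,d\theta_I\wedge dr_J$ (torus-invariant forms), and let $\Omega_B^{(p,q)^\Lambda}(X)$ be the subspace of those with $|I|=p$, $|J|=q$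 in all terms ($p$ directions along the polarization $\Lambda$ by torus fibres and $q$ base directions). Let $\Omega_B^{p,q}(\check X)$ be the space of smooth $(p,q)$-forms on $\check X$ that are locally $\sum_{|I|=p,|J|=q} a_{IJ}(r)\,dz_I\wedge d\bar z_J$, and $\Omega_B^*(\check X)=\bigoplus_{p,q}\Omega_B^{p,q}(\check X)$. Let $d^\Lambda=d\circ L^*-L^*\circ d$, where $L^*=\sum_i\iota_{\partial/\partial r_i}\iota_{\partial/\partial\theta_i}$ is the dual Lefschetz operator of $\omega$. Put $$H^{(p,q)^\Lambda}_{B,d+d^\Lambda}(X,\mathbb C)=\frac{\ker(d+d^\Lambda)\cap\Omega_B^{(p,q)^\Lambda}(X)}{\operatorname{im}(dd^\Lambda)\cap\Omega_B^{(p,q)^\Lambda}(X)},\qquad H^{p,q}_{B,BC}(\check X)=\frac{\ker(d)\cap\Omega_B^{p,q}(\check X)}{\operatorname{im}(\partial\bar\partial)\cap\Omega_B^{p,q}(\check X)},$$ where $dd^\Lambda$ acts on $\Omega_B^*(X,\mathbb C)$ and $\partial\bar\partial$ acts on $\Omega_B^*(\check X)$. On $X\times_B\check X$, with projections $\pi_X$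 to $X$ and $\pi_{\check X}$ to $\check X$, put $K=\sum_i d\check\theta_i\wedge d\theta_i$. Let $\mathcal P$ be the operator $a_{IJ}\,dz_I\wedge d\bar z_J\mapsto a_{IJ}\,d\check\theta_I\wedge dr_J$. The Fourier–Mukai transforms are $$\mathrm{FT}(\check\phi)=(\pi_X)_*\big(\pi_{\check X}^*(\mathcal P\check\phi)\wedge e^{K}\big),\qquad \mathrm{FT}(\phi)=\mathcal P^{-1}(\pi_{\check X})_*\big(\pi_X^*\phi\wedge e^{-K}\big)$$ for torus-invariant forms $\check\phi$ on $\check X$ and $\phi$ on $X$, where the push-forwards are integration along the torus fibres. Theorem. For all integers $0\le p\le n$ and $q\ge 0$, the Fourier–Mukai transforms map the cocycles defining $H^{(n-p,q)^\Lambda}_{B,d+d^\Lambda}(X,\mathbb C)$ and $H^{p,q}_{B,BC}(\check X)$ to each other, and each of them induces (by $[\phi]\mapsto[\mathrm{FT}(\phi)]$, respectively $[\check\phi]\mapsto[\mathrm{FT}(\check\phi)]$) an isomorphism of complex vector spaces $$H^{(n-p,q)^\Lambda}_{B,d+d^\Lambda}(X,\mathbb C)\;\cong\;H^{p,q}_{B,BC}(\check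 X).$$ -/

import Mathlib

open scoped Manifold ContDiff

noncomputable section

namespace SemiFlat

/-! ### Complex-valued exterior forms on a real vector space -/

section Exterior

variable {V W : Type*} [AddCommGroup V] [Module ℝ V] [AddCommGroup W] [Module ℝ W]

/-- `Ext V = Λ^*(V^* ⊗ ℂ)`: (inhomogeneous) complex-valued exterior forms on the real vector space
`V`.  The product of this algebra is the wedge product. -/
abbrev Ext (V : Type*) [AddCommGroup V] [Module ℝ V] : Type _ := ExteriorAlgebra ℂ (V →ₗ[ℝ] ℂ)

/-- A complex-valued covector as an exterior form of degree one. -/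
abbrev form1 (α : V →ₗ[ℝ] ℂ) : Ext V := ExteriorAlgebra.ι ℂ α

/-- Pullback of exterior forms along a real linear map. -/
def pull (f : V →ₗ[ℝ] W) : Ext W →ₐ[ℂ] Ext V :=
  ExteriorAlgebra.map (LinearMap.lcomp ℂ ℂ f)

/-- Evaluation of covectors at a vector. -/
def evalAt (v : V) : Module.Dual ℂ (V →ₗ[ℝ] ℂ) where
  toFun α := α v
  map_add' _ _ := rfl
  map_smul' _ _ := rfl

/-- Interior product `ι_v` with a vector (the antiderivation that evaluates covectors at `v`). -/
def inter (v : V) : Ext V →ₗ[ℂ] Ext V := CliffordAlgebra.contractLeft (evalAt v)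

/-- Left wedge multiplication by a covector. -/
def wedgeL (α : V →ₗ[ℝ] ℂ) : Ext V →ₗ[ℂ] Ext V := LinearMap.mulLeft ℂ (form1 α)

/-- Forms with `p` factors from the covectors `α i` and `q` factors from the covectors `β j`, that
is, the span of the products `α i₁ ∧ ⋯ ∧ α i_p ∧ β j₁ ∧ ⋯ ∧ β j_q`. -/
def bidegree {ι : Type*} (α β : ι → V →ₗ[ℝ] ℂ) (p q : ℕ) : Submodule ℂ (Ext V) :=
  Submodule.span ℂ (Set.range fun i => form1 (α i)) ^ p *
    Submodule.span ℂ (Set.range fun i => form1 (β i)) ^ q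

instance extFinite [Module.Finite ℝ V] : Module.Finite ℂ (Ext V) :=
  Module.Finite.of_basis (Module.finBasis ℂ (V →ₗ[ℝ] ℂ)).ExteriorAlgebra

end Exterior
/-! ### Calculus for maps into a finite-dimensional complex vector space, coordinate by coordinate -/

section Calculus

variable {H W W' : Type*} [NormedAddCommGroup H] [NormedSpace ℝ H]
  [AddCommGroup W] [Module ℂ W] [AddCommGroup W'] [Module ℂ W']

/-- Smoothness on `U`: all components are smooth. -/
def SmoothOn (f : H → W) (U : Set H) : Prop :=
  ∀ l : Module.Dual ℂ W, ContDiffOn ℝ ∞ (fun y => l (f y)) U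

theorem SmoothOn.add {f g : H → W} {U : Set H} (hf : SmoothOn f U) (hg : SmoothOn g U) :
    SmoothOn (fun y => f y + g y) U := fun l => by
  simpa only [map_add] using (hf l).add (hg l)

theorem SmoothOn.smul {f : H → W} {U : Set H} (c : ℂ) (hf : SmoothOn f U) :
    SmoothOn (fun y => c • f y) U := fun l => by
  simpa only [map_smul] using (hf l).const_smul c

theorem SmoothOn.zero {U : Set H} : SmoothOn (fun _ : H => (0 : W)) U := fun l => by
  simpa only [map_zero] using contDiffOn_const

theorem SmoothOn.sum {ι : Type*} (s : Finset ι) {f : ι → H → W} {U : Set H}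
    (hf : ∀ i, SmoothOn (f i) U) : SmoothOn (fun y => ∑ i ∈ s, f i y) U := fun l => by
  simpa only [map_sum] using ContDiffOn.sum fun i _ => hf i l

theorem SmoothOn.linear {f : H → W} {U : Set H} (T : W →ₗ[ℂ] W') (hf : SmoothOn f U) :
    SmoothOn (fun y => T (f y)) U := fun l => hf (l.comp T)

theorem SmoothOn.congr {f g : H → W} {U : Set H} (hf : SmoothOn f U) (h : ∀ y ∈ U, g y = f y) :
    SmoothOn g U := fun l => (hf l).congr fun y hy => by simp only [h y hy]

theorem SmoothOn.differentiableAt {f : H → W} {U : Set H} (hU : IsOpen U) (hf : SmoothOn f U)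
    {y : H} (hy : y ∈ U) (l : Module.Dual ℂ W) : DifferentiableAt ℝ (fun u => l (f u)) y :=
  ((hf l).contDiffAt (hU.mem_nhds hy)).differentiableAt (by simp)

variable [Module.Finite ℂ W]

/-- The directional derivative at `y` in the direction `v`, taken on the components of `f`. -/
def partialD (v : H) (f : H → W) (y : H) : W :=
  ∑ j, fderiv ℝ (fun u => (Module.finBasis ℂ W).coord j (f u)) y v • Module.finBasis ℂ W j

/-- The integral of `f` over `s`, taken on the components of `f`. -/
def setIntegral {m : ℕ} (s : Set (Fin m → ℝ)) (f : (Fin m → ℝ) → W) : W :=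
  ∑ j, (∫ t in s, (Module.finBasis ℂ W).coord j (f t)) • Module.finBasis ℂ W j

/-- `partialD` does not depend on the basis: it is characterised through all linear functionals. -/
theorem dual_partialD {f : H → W} {U : Set H} (hU : IsOpen U) (hf : SmoothOn f U)
    {y : H} (hy : y ∈ U) (v : H) (l : Module.Dual ℂ W) :
    l (partialD v f y) = fderiv ℝ (fun u => l (f u)) y v := by
  set b := Module.finBasis ℂ W
  have h : (fun u => l (f u)) = fun u => ∑ j, l (b j) • b.coord j (f u) := by
    funext u
    have h1 := congrArg l (b.sum_repr (f u))
    rw [map_sum] at h1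
    rw [← h1]
    refine Finset.sum_congr rfl fun j _ => ?_
    rw [map_smul, Module.Basis.coord_apply, smul_eq_mul, smul_eq_mul, mul_comm]
  have hd : ∀ j ∈ Finset.univ, DifferentiableAt ℝ (fun u => l (b j) • b.coord j (f u)) y :=
    fun j _ => (hf.differentiableAt hU hy (b.coord j)).fun_const_smul _
  rw [h, fderiv_fun_sum hd, partialD, map_sum, sum_apply]
  refine Finset.sum_congr rfl fun j _ => ?_
  rw [fderiv_fun_const_smul (hf.differentiableAt hU hy (b.coord j))]
  simp [b, mul_comm]

theorem partialD_ext {x y : W} (h : ∀ l : Module.Dual ℂ W, l x = l y) : x = y :=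
  (Module.finBasis ℂ W).ext_elem fun j => h ((Module.finBasis ℂ W).coord j)

theorem partialD_add {f g : H → W} {U : Set H} (hU : IsOpen U) (hf : SmoothOn f U)
    (hg : SmoothOn g U) {y : H} (hy : y ∈ U) (v : H) :
    partialD v (fun u => f u + g u) y = partialD v f y + partialD v g y := partialD_ext fun l => by
  rw [dual_partialD hU (hf.add hg) hy, map_add, dual_partialD hU hf hy, dual_partialD hU hg hy]
  simp only [map_add]
  rw [fderiv_fun_add (hf.differentiableAt hU hy l) (hg.differentiableAt hU hy l)]
  rfl

theorem partialD_smul {f : H → W} {U : Set H} (hU : IsOpen U) (hf : SmoothOn f U) (c : ℂ)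
    {y : H} (hy : y ∈ U) (v : H) :
    partialD v (fun u => c • f u) y = c • partialD v f y := partialD_ext fun l => by
  rw [dual_partialD hU (hf.smul c) hy, map_smul, dual_partialD hU hf hy]
  simp only [map_smul]
  rw [fderiv_fun_const_smul (hf.differentiableAt hU hy l)]
  rfl

theorem SmoothOn.partialD {f : H → W} {U : Set H} (hU : IsOpen U) (hf : SmoothOn f U) (v : H) :
    SmoothOn (partialD v f) U := fun l => by
  refine ContDiffOn.congr (f := fun y => fderiv ℝ (fun u => l (f u)) y v) ?_
    fun y hy => dual_partialD hU hf hy v l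
  exact ((hf l).fderiv_of_isOpen hU (by simp)).clm_apply contDiffOn_const

theorem partialD_congr {f g : H → W} {U : Set H} (hU : IsOpen U) (h : ∀ y ∈ U, f y = g y)
    {y : H} (hy : y ∈ U) (v : H) : SemiFlat.partialD v f y = SemiFlat.partialD v g y := by
  unfold SemiFlat.partialD
  refine Finset.sum_congr rfl fun j _ => ?_
  have : (fun u => (Module.finBasis ℂ W).coord j (f u)) =ᶠ[nhds y]
      fun u => (Module.finBasis ℂ W).coord j (g u) := by
    filter_upwards [hU.mem_nhds hy] with u hu
    rw [h u hu]
  rw [this.fderiv_eq]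

end Calculus

/-! ### Local coordinates -/

section Coordinates

variable {n : ℕ}

/-- The coordinate space of action-angle coordinates `(r, θ)`. -/
abbrev Dar (n : ℕ) : Type := (Fin n → ℝ) × (Fin n → ℝ)

/-- The coordinate space of the complex coordinates `z = θ̌ + i r` of the mirror. -/
abbrev Cpx (n : ℕ) : Type := Fin n → ℂ

/-- Imaginary part `r` of `z = θ̌ + i r`. -/
abbrev imPart (z : Cpx n) : Fin n → ℝ := fun i => (z i).im

/-- The point `z = θ̌ + i r`. -/
abbrev mkCpx (r t : Fin n → ℝ) : Cpx n := fun i => (t i : ℂ) + Complex.I * (r i : ℂ)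

/-- The covector `dr_i`. -/
def dr (i : Fin n) : Dar n →ₗ[ℝ] ℂ :=
  Complex.ofRealCLM.toLinearMap ∘ₗ LinearMap.proj i ∘ₗ LinearMap.fst ℝ _ _

/-- The covector `dθ_i`. -/
def dth (i : Fin n) : Dar n →ₗ[ℝ] ℂ :=
  Complex.ofRealCLM.toLinearMap ∘ₗ LinearMap.proj i ∘ₗ LinearMap.snd ℝ _ _

/-- The vector `∂/∂r_i`. -/
def er (i : Fin n) : Dar n := (Pi.single i 1, 0)

/-- The vector `∂/∂θ_i`. -/
def eth (i : Fin n) : Dar n := (0, Pi.single i 1)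

/-- The exterior derivative in the coordinates `(r, θ)`. -/
def dLoc (f : Dar n → Ext (Dar n)) (y : Dar n) : Ext (Dar n) :=
  ∑ i, wedgeL (dr i) (partialD (er i) f y) + ∑ i, wedgeL (dth i) (partialD (eth i) f y)

/-- The dual Lefschetz operator `Λ = ∑ ι_{∂/∂r_i} ι_{∂/∂θ_i}` of `∑ dθ_i ∧ dr_i`. -/
def lefDual : Ext (Dar n) →ₗ[ℂ] Ext (Dar n) := ∑ i, inter (er i) ∘ₗ inter (eth i)

/-- The symplectic adjoint `d^Λ = d Λ - Λ d` in the coordinates `(r, θ)`. -/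
def dLamLoc (f : Dar n → Ext (Dar n)) (y : Dar n) : Ext (Dar n) :=
  dLoc (fun u => lefDual (f u)) y - lefDual (dLoc f y)

/-- The covector `dz_i`. -/
def dz (i : Fin n) : Cpx n →ₗ[ℝ] ℂ := LinearMap.proj i

/-- The covector `d z̄_i`. -/
def dzbar (i : Fin n) : Cpx n →ₗ[ℝ] ℂ := Complex.conjAe.toLinearMap ∘ₗ LinearMap.proj i

/-- The covector `dθ̌_i`. -/
def dthC (i : Fin n) : Cpx n →ₗ[ℝ] ℂ :=
  Complex.ofRealCLM.toLinearMap ∘ₗ Complex.reLm ∘ₗ LinearMap.proj i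

/-- The covector `dr_i` in the coordinates of the mirror. -/
def drC (i : Fin n) : Cpx n →ₗ[ℝ] ℂ :=
  Complex.ofRealCLM.toLinearMap ∘ₗ Complex.imLm ∘ₗ LinearMap.proj i

/-- The vector `∂/∂θ̌_i`. -/
def ethC (i : Fin n) : Cpx n := Pi.single i 1

/-- The vector `∂/∂r_i` in the coordinates of the mirror. -/
def erC (i : Fin n) : Cpx n := Pi.single i Complex.I

/-- The exterior derivative in the coordinates `z = θ̌ + i r`. -/
def dCLoc (f : Cpx n → Ext (Cpx n)) (z : Cpx n) : Ext (Cpx n) :=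
  ∑ i, wedgeL (dthC i) (partialD (ethC i) f z) + ∑ i, wedgeL (drC i) (partialD (erC i) f z)

/-- `∂ f = ∑ dz_i ∧ ∂f/∂z_i` with `∂/∂z_i = (∂/∂θ̌_i - i ∂/∂r_i) / 2`. -/
def delLoc (f : Cpx n → Ext (Cpx n)) (z : Cpx n) : Ext (Cpx n) :=
  ∑ i, wedgeL (dz i)
    ((1 / 2 : ℂ) • (partialD (ethC i) f z - Complex.I • partialD (erC i) f z))

/-- `∂̄ f = ∑ d z̄_i ∧ ∂f/∂z̄_i` with `∂/∂z̄_i = (∂/∂θ̌_i + i ∂/∂r_i) / 2`. -/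
def delbarLoc (f : Cpx n → Ext (Cpx n)) (z : Cpx n) : Ext (Cpx n) :=
  ∑ i, wedgeL (dzbar i)
    ((1 / 2 : ℂ) • (partialD (ethC i) f z + Complex.I • partialD (erC i) f z))

/-! Linearity and smoothness of these operators on smooth functions. -/

theorem smoothOn_dLoc {f : Dar n → Ext (Dar n)} {U : Set (Dar n)} (hU : IsOpen U)
    (hf : SmoothOn f U) : SmoothOn (dLoc f) U :=
  (SmoothOn.sum _ fun i => (hf.partialD hU (er i)).linear (wedgeL (dr i))).add
    (SmoothOn.sum _ fun i => (hf.partialD hU (eth i)).linear (wedgeL (dth i)))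

theorem dLoc_add {f g : Dar n → Ext (Dar n)} {U : Set (Dar n)} (hU : IsOpen U)
    (hf : SmoothOn f U) (hg : SmoothOn g U) {y : Dar n} (hy : y ∈ U) :
    dLoc (fun u => f u + g u) y = dLoc f y + dLoc g y := by
  simp only [dLoc, partialD_add hU hf hg hy, map_add, Finset.sum_add_distrib]
  abel

theorem dLoc_smul {f : Dar n → Ext (Dar n)} {U : Set (Dar n)} (hU : IsOpen U)
    (hf : SmoothOn f U) (c : ℂ) {y : Dar n} (hy : y ∈ U) :
    dLoc (fun u => c • f u) y = c • dLoc f y := by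
  simp only [dLoc, partialD_smul hU hf c hy, map_smul, ← Finset.smul_sum, ← smul_add]

theorem dLoc_congr {f g : Dar n → Ext (Dar n)} {U : Set (Dar n)} (hU : IsOpen U)
    (h : ∀ y ∈ U, f y = g y) {y : Dar n} (hy : y ∈ U) : dLoc f y = dLoc g y := by
  simp only [dLoc, partialD_congr hU h hy]

theorem smoothOn_dLamLoc {f : Dar n → Ext (Dar n)} {U : Set (Dar n)} (hU : IsOpen U)
    (hf : SmoothOn f U) : SmoothOn (dLamLoc f) U := by
  have h := (smoothOn_dLoc hU (hf.linear lefDual)).add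
    (((smoothOn_dLoc hU hf).linear lefDual).smul (-1))
  exact h.congr fun y _ => by simp [dLamLoc, sub_eq_add_neg]

theorem dLamLoc_add {f g : Dar n → Ext (Dar n)} {U : Set (Dar n)} (hU : IsOpen U)
    (hf : SmoothOn f U) (hg : SmoothOn g U) {y : Dar n} (hy : y ∈ U) :
    dLamLoc (fun u => f u + g u) y = dLamLoc f y + dLamLoc g y := by
  simp only [dLamLoc, map_add, dLoc_add hU hf hg hy,
    dLoc_add hU (hf.linear lefDual) (hg.linear lefDual) hy]
  abel

theorem dLamLoc_smul {f : Dar n → Ext (Dar n)} {U : Set (Dar n)} (hU : IsOpen U)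
    (hf : SmoothOn f U) (c : ℂ) {y : Dar n} (hy : y ∈ U) :
    dLamLoc (fun u => c • f u) y = c • dLamLoc f y := by
  simp only [dLamLoc, map_smul, dLoc_smul hU hf c hy, dLoc_smul hU (hf.linear lefDual) c hy,
    smul_sub]

theorem dLoc_dLamLoc_add {f g : Dar n → Ext (Dar n)} {U : Set (Dar n)} (hU : IsOpen U)
    (hf : SmoothOn f U) (hg : SmoothOn g U) {y : Dar n} (hy : y ∈ U) :
    dLoc (dLamLoc fun u => f u + g u) y = dLoc (dLamLoc f) y + dLoc (dLamLoc g) y := by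
  rw [dLoc_congr hU (fun u hu => dLamLoc_add hU hf hg hu) hy,
    dLoc_add hU (smoothOn_dLamLoc hU hf) (smoothOn_dLamLoc hU hg) hy]

theorem dLoc_dLamLoc_smul {f : Dar n → Ext (Dar n)} {U : Set (Dar n)} (hU : IsOpen U)
    (hf : SmoothOn f U) (c : ℂ) {y : Dar n} (hy : y ∈ U) :
    dLoc (dLamLoc fun u => c • f u) y = c • dLoc (dLamLoc f) y := by
  rw [dLoc_congr hU (fun u hu => dLamLoc_smul hU hf c hu) hy,
    dLoc_smul hU (smoothOn_dLamLoc hU hf) c hy]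

theorem dCLoc_add {f g : Cpx n → Ext (Cpx n)} {U : Set (Cpx n)} (hU : IsOpen U)
    (hf : SmoothOn f U) (hg : SmoothOn g U) {z : Cpx n} (hz : z ∈ U) :
    dCLoc (fun u => f u + g u) z = dCLoc f z + dCLoc g z := by
  simp only [dCLoc, partialD_add hU hf hg hz, map_add, Finset.sum_add_distrib]
  abel

theorem dCLoc_smul {f : Cpx n → Ext (Cpx n)} {U : Set (Cpx n)} (hU : IsOpen U)
    (hf : SmoothOn f U) (c : ℂ) {z : Cpx n} (hz : z ∈ U) :
    dCLoc (fun u => c • f u) z = c • dCLoc f z := by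
  simp only [dCLoc, partialD_smul hU hf c hz, map_smul, ← Finset.smul_sum, ← smul_add]

theorem delLoc_add {f g : Cpx n → Ext (Cpx n)} {U : Set (Cpx n)} (hU : IsOpen U)
    (hf : SmoothOn f U) (hg : SmoothOn g U) {z : Cpx n} (hz : z ∈ U) :
    delLoc (fun u => f u + g u) z = delLoc f z + delLoc g z := by
  simp only [delLoc, partialD_add hU hf hg hz, ← Finset.sum_add_distrib, ← map_add]
  refine Finset.sum_congr rfl fun i _ => congrArg _ ?_
  module

theorem delLoc_smul {f : Cpx n → Ext (Cpx n)} {U : Set (Cpx n)} (hU : IsOpen U)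
    (hf : SmoothOn f U) (c : ℂ) {z : Cpx n} (hz : z ∈ U) :
    delLoc (fun u => c • f u) z = c • delLoc f z := by
  simp only [delLoc, partialD_smul hU hf c hz, Finset.smul_sum, ← map_smul]
  refine Finset.sum_congr rfl fun i _ => congrArg _ ?_
  module

theorem delLoc_congr {f g : Cpx n → Ext (Cpx n)} {U : Set (Cpx n)} (hU : IsOpen U)
    (h : ∀ z ∈ U, f z = g z) {z : Cpx n} (hz : z ∈ U) : delLoc f z = delLoc g z := by
  simp only [delLoc, partialD_congr hU h hz]

theorem smoothOn_delbarLoc {f : Cpx n → Ext (Cpx n)} {U : Set (Cpx n)} (hU : IsOpen U)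
    (hf : SmoothOn f U) : SmoothOn (delbarLoc f) U :=
  SmoothOn.sum _ fun i => (((hf.partialD hU (ethC i)).add
    ((hf.partialD hU (erC i)).smul Complex.I)).smul (1 / 2)).linear (wedgeL (dzbar i))

theorem delbarLoc_add {f g : Cpx n → Ext (Cpx n)} {U : Set (Cpx n)} (hU : IsOpen U)
    (hf : SmoothOn f U) (hg : SmoothOn g U) {z : Cpx n} (hz : z ∈ U) :
    delbarLoc (fun u => f u + g u) z = delbarLoc f z + delbarLoc g z := by
  simp only [delbarLoc, partialD_add hU hf hg hz, ← Finset.sum_add_distrib, ← map_add]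
  refine Finset.sum_congr rfl fun i _ => congrArg _ ?_
  module

theorem delbarLoc_smul {f : Cpx n → Ext (Cpx n)} {U : Set (Cpx n)} (hU : IsOpen U)
    (hf : SmoothOn f U) (c : ℂ) {z : Cpx n} (hz : z ∈ U) :
    delbarLoc (fun u => c • f u) z = c • delbarLoc f z := by
  simp only [delbarLoc, partialD_smul hU hf c hz, Finset.smul_sum, ← map_smul]
  refine Finset.sum_congr rfl fun i _ => congrArg _ ?_
  module

theorem delLoc_delbarLoc_add {f g : Cpx n → Ext (Cpx n)} {U : Set (Cpx n)} (hU : IsOpen U)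
    (hf : SmoothOn f U) (hg : SmoothOn g U) {z : Cpx n} (hz : z ∈ U) :
    delLoc (delbarLoc fun u => f u + g u) z =
      delLoc (delbarLoc f) z + delLoc (delbarLoc g) z := by
  rw [delLoc_congr hU (fun u hu => delbarLoc_add hU hf hg hu) hz,
    delLoc_add hU (smoothOn_delbarLoc hU hf) (smoothOn_delbarLoc hU hg) hz]

theorem delLoc_delbarLoc_smul {f : Cpx n → Ext (Cpx n)} {U : Set (Cpx n)} (hU : IsOpen U)
    (hf : SmoothOn f U) (c : ℂ) {z : Cpx n} (hz : z ∈ U) :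
    delLoc (delbarLoc fun u => c • f u) z = c • delLoc (delbarLoc f) z := by
  rw [delLoc_congr hU (fun u hu => delbarLoc_smul hU hf c hu) hz,
    delLoc_smul hU (smoothOn_delbarLoc hU hf) c hz]

/-! ### Fourier-Mukai transform in coordinates -/

/-- The complex-linear map on covectors with `dz_i ↦ dθ̌_i` and `d z̄_i ↦ dr_i`; the coefficients of
`α = ∑ a_i dz_i + b_i d z̄_i` are `a_i = α(∂/∂z_i)` and `b_i = α(∂/∂z̄_i)`. -/
def switch1 : (Cpx n →ₗ[ℝ] ℂ) →ₗ[ℂ] (Cpx n →ₗ[ℝ] ℂ) :=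
  ∑ i, (((1 / 2 : ℂ) • (evalAt (ethC i) - Complex.I • evalAt (erC i))).smulRight (dthC i)
    + ((1 / 2 : ℂ) • (evalAt (ethC i) + Complex.I • evalAt (erC i))).smulRight (drC i))

/-- The complex-linear map on covectors with `dθ̌_i ↦ dz_i` and `dr_i ↦ d z̄_i`. -/
def unswitch1 : (Cpx n →ₗ[ℝ] ℂ) →ₗ[ℂ] (Cpx n →ₗ[ℝ] ℂ) :=
  ∑ i, ((evalAt (ethC i)).smulRight (dz i) + (evalAt (erC i)).smulRight (dzbar i))

/-- The polarization switch operator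
`P (a dz_I ∧ d z̄_J) = a dθ̌_I ∧ dr_J`. -/
def polSwitch : Ext (Cpx n) →ₐ[ℂ] Ext (Cpx n) := ExteriorAlgebra.map switch1

/-- The inverse of the polarization switch operator,
`a dθ̌_I ∧ dr_J ↦ a dz_I ∧ d z̄_J`. -/
def polUnswitch : Ext (Cpx n) →ₐ[ℂ] Ext (Cpx n) := ExteriorAlgebra.map unswitch1

/-- The coordinate space of the fibre product of the two torus bundles: `((r, θ), θ̌)`. -/
abbrev Fib (n : ℕ) : Type := Dar n × (Fin n → ℝ)

/-- The projection of the fibre product to the symplectic side, `((r, θ), θ̌) ↦ (r, θ)`. -/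
def toDar : Fib n →ₗ[ℝ] Dar n := LinearMap.fst ℝ _ _

/-- The projection of the fibre product to the complex side, `((r, θ), θ̌) ↦ θ̌ + i r`. -/
def toCpx : Fib n →ₗ[ℝ] Cpx n where
  toFun w := mkCpx w.1.1 w.2
  map_add' v w := by
    funext i
    simp [mkCpx]
    ring
  map_smul' c w := by
    funext i
    simp [mkCpx]
    ring

/-- The section `(r, θ) ↦ ((r, θ), 0)` of the first projection. -/
def ofDar : Dar n →ₗ[ℝ] Fib n := LinearMap.inl ℝ _ _

/-- The section `θ̌ + i r ↦ ((r, 0), θ̌)` of the second projection. -/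
def ofCpx : Cpx n →ₗ[ℝ] Fib n where
  toFun z := ((imPart z, 0), fun i => (z i).re)
  map_add' v w := by
    ext i <;> simp [imPart]
  map_smul' c w := by
    ext i <;> simp [imPart]

/-- `F / 2i = ∑ dθ̌_i ∧ dθ_i`, where `F` is the curvature of the universal connection. -/
def curv : Ext (Fib n) :=
  ∑ i, form1 (Complex.ofRealCLM.toLinearMap ∘ₗ LinearMap.proj i ∘ₗ LinearMap.snd ℝ (Dar n) _) *
    form1 (dth i ∘ₗ toDar)

/-- The exponential series of a 2-form that is a sum of `n` products of two covectors; the terms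
with `m > n` vanish. -/
def expForm (K : Ext (Fib n)) : Ext (Fib n) :=
  ∑ m ∈ Finset.range (n + 1), ((m.factorial : ℂ)⁻¹) • K ^ m

/-- Contraction `ι_{v_n} ⋯ ι_{v_1}` with the fibre directions, so that
`α_1 ∧ ⋯ ∧ α_n ∧ β ↦ β` if `α_i(v_j) = δ_ij` and the `v_j` do not pair with `β`. -/
def contractAll {V : Type*} [AddCommGroup V] [Module ℝ V] (v : Fin n → V) (ψ : Ext V) : Ext V :=
  (List.finRange n).foldl (fun χ i => inter (v i) χ) ψ

/-- The Fourier-Mukai transform `π_* (π̌^* (P φ̌) ∧ exp (F / 2i))` in coordinates: the integral runs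
over the torus fibre `{θ̌} = ℝⁿ / ℤⁿ`. -/
def ftLoc (f : Cpx n → Ext (Cpx n)) (y : Dar n) : Ext (Dar n) :=
  setIntegral (Set.Icc (0 : Fin n → ℝ) 1) fun t =>
    pull ofDar (contractAll (fun i => ((0, Pi.single i 1) : Fib n))
      (pull toCpx (polSwitch (f (mkCpx y.1 t))) * expForm curv))

/-- The Fourier-Mukai transform `P⁻¹ π̌_* (π^* φ ∧ exp (- F / 2i))` in coordinates: the integral runs
over the torus fibre `{θ} = ℝⁿ / ℤⁿ`. -/
def ftInvLoc (f : Dar n → Ext (Dar n)) (z : Cpx n) : Ext (Cpx n) :=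
  polUnswitch (setIntegral (Set.Icc (0 : Fin n → ℝ) 1) fun t =>
    pull ofCpx (contractAll (fun i => ((eth i, 0) : Fib n))
      (pull toDar (f (imPart z, t)) * expForm (-curv))))

end Coordinates

/-! ### Semi-flat mirror pairs -/

section Geometry

variable {n : ℕ}

/-- A matrix in `SL(n, ℤ)` acting on `ℝⁿ`. -/
def act (A : Matrix.SpecialLinearGroup (Fin n) ℤ) (v : Fin n → ℝ) : Fin n → ℝ :=
  ((A : Matrix (Fin n) (Fin n) ℤ).map (Int.cast : ℤ → ℝ)).mulVec v

/-- The inverse transpose of a matrix in `SL(n, ℤ)` acting on `ℝⁿ`. -/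
def coact (A : Matrix.SpecialLinearGroup (Fin n) ℤ) (v : Fin n → ℝ) : Fin n → ℝ :=
  act A⁻¹.transpose v

/-- A Lagrangian torus bundle `proj : X → B` with symplectic form `σ` on `X`, together with an atlas
of semi-flat (action-angle) coordinates `(r, θ)`: over the domain of the action coordinates
`r = chart a`, the map `par a` identifies `{(r, θ)}`, with `θ` taken modulo `ℤⁿ`, with the preimage
of that domain in `X`, and `σ = ∑ dθ_i ∧ dr_i`.  The changes of coordinates are locally
`r' = A r + b`, `θ' = A^{-T} θ + c` with `A ∈ SL(n, ℤ)` and constant `b`, `c`. -/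
structure TorusBundle (n : ℕ) (ι B X : Type*) [TopologicalSpace B] [TopologicalSpace X]
    [ChartedSpace (Dar n) X]
    (σ : ∀ x : X, TangentSpace 𝓘(ℝ, Dar n) x →ₗ[ℝ] TangentSpace 𝓘(ℝ, Dar n) x →ₗ[ℝ] ℝ) where
  /-- the bundle projection -/
  proj : X → B
  /-- action coordinates on the base -/
  chart : ι → OpenPartialHomeomorph B (Fin n → ℝ)
  /-- the inverses of the action-angle coordinates -/
  par : ι → Dar n → X
  cover : ∀ b : B, ∃ a, b ∈ (chart a).source
  isLocalDiffeo : ∀ a, IsLocalDiffeomorphOn 𝓘(ℝ, Dar n) 𝓘(ℝ, Dar n) ∞ (par a)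
    {y | y.1 ∈ (chart a).target}
  proj_par : ∀ a, ∀ r ∈ (chart a).target, ∀ θ, proj (par a (r, θ)) = (chart a).symm r
  par_surj : ∀ a x, proj x ∈ (chart a).source → ∃ θ, par a (chart a (proj x), θ) = x
  par_eq_iff : ∀ a, ∀ r ∈ (chart a).target, ∀ θ θ' : Fin n → ℝ,
    par a (r, θ) = par a (r, θ') ↔ ∃ m : Fin n → ℤ, θ' = θ + fun i => (m i : ℝ)
  darboux : ∀ a, ∀ y : Dar n, y.1 ∈ (chart a).target → ∀ v w : Dar n,
    σ (par a y) (mfderiv 𝓘(ℝ, Dar n) 𝓘(ℝ, Dar n) (par a) y v)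
      (mfderiv 𝓘(ℝ, Dar n) 𝓘(ℝ, Dar n) (par a) y w) = ∑ i, (v.2 i * w.1 i - v.1 i * w.2 i)
  transition : ∀ a a' (y y' : Dar n), y.1 ∈ (chart a).target → y'.1 ∈ (chart a').target →
    par a y = par a' y' → ∃ A : Matrix.SpecialLinearGroup (Fin n) ℤ,
      ∀ᶠ h in nhds (0 : Dar n), par a (y + h) = par a' (y' + (act A h.1, coact A h.2))

variable {ι B X : Type*} [TopologicalSpace B] [TopologicalSpace X] [ChartedSpace (Dar n) X]
  {σ : ∀ x : X, TangentSpace 𝓘(ℝ, Dar n) x →ₗ[ℝ] TangentSpace 𝓘(ℝ, Dar n) x →ₗ[ℝ] ℝ}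

/-- Near `b`, the change from the action coordinates `chart a` to `chart a'` is an affine map with
linear part `A`. -/
def TorusBundle.HasLinearPart (S : TorusBundle n ι B X σ) (a a' : ι) (b : B)
    (A : Matrix.SpecialLinearGroup (Fin n) ℤ) : Prop :=
  ∀ᶠ b' in nhds b, S.chart a' b' = S.chart a' b + act A (S.chart a b' - S.chart a b)

/-- The mirror of a Lagrangian torus bundle: the dual torus bundle `Xc → B`, whose points over `b`
are the flat `U(1)`-connections on the fibre of `X` over `b`.  The point with coordinates
`z = θ̌ + i r` stands for the connection with holonomies `exp (2 π i θ̌_j)` along the cycles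
`θ_j ↦ θ_j + 1`; so `θ̌` is taken modulo `ℤⁿ` and it changes by `θ̌' = A θ̌` where `θ` changes by
`A^{-T}`.  The complex structure is the one for which the `z_j` are holomorphic coordinates. -/
structure Mirror (S : TorusBundle n ι B X σ) (Xc : Type*) [TopologicalSpace Xc]
    [ChartedSpace (Cpx n) Xc] where
  /-- the projection of the dual torus bundle -/
  proj : Xc → B
  /-- the inverses of the coordinates `z = θ̌ + i r` -/
  par : ι → Cpx n → Xc
  isLocalBihol : ∀ a, IsLocalDiffeomorphOn 𝓘(ℂ, Cpx n) 𝓘(ℂ, Cpx n) ω (par a)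
    {z | imPart z ∈ (S.chart a).target}
  proj_par : ∀ a z, imPart z ∈ (S.chart a).target → proj (par a z) = (S.chart a).symm (imPart z)
  par_surj : ∀ a p, proj p ∈ (S.chart a).source →
    ∃ t, par a (mkCpx (S.chart a (proj p)) t) = p
  par_eq_iff : ∀ a, ∀ r ∈ (S.chart a).target, ∀ t t' : Fin n → ℝ,
    par a (mkCpx r t) = par a (mkCpx r t') ↔ ∃ m : Fin n → ℤ, t' = t + fun i => (m i : ℝ)
  transition : ∀ a a' b (A : Matrix.SpecialLinearGroup (Fin n) ℤ), b ∈ (S.chart a).source →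
    b ∈ (S.chart a').source → S.HasLinearPart a a' b A →
    ∀ t, par a (mkCpx (S.chart a b) t) = par a' (mkCpx (S.chart a' b) (act A t))

variable (S : TorusBundle n ι B X σ)

/-- (Arbitrary sections giving) complex-valued forms on `X`, of mixed degree. -/
abbrev Form (n : ℕ) (X : Type*) [TopologicalSpace X] [ChartedSpace (Dar n) X] : Type _ :=
  ∀ x : X, Ext (TangentSpace 𝓘(ℝ, Dar n) x)

/-- The expression of a form in the coordinates `(r, θ)`. -/
def TorusBundle.rep (a : ι) (φ : Form n X) (y : Dar n) : Ext (Dar n) :=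
  let D : Dar n →L[ℝ] TangentSpace 𝓘(ℝ, Dar n) (S.par a y) :=
    mfderiv 𝓘(ℝ, Dar n) 𝓘(ℝ, Dar n) (S.par a) y
  pull D.toLinearMap (φ (S.par a y))

/-- The domain of the coordinates `(r, θ)`. -/
def TorusBundle.dom (a : ι) : Set (Dar n) := {y | y.1 ∈ (S.chart a).target}

variable {Xc : Type*} [TopologicalSpace Xc] [ChartedSpace (Cpx n) Xc] {S}
variable (M : Mirror S Xc)

/-- (Arbitrary sections giving) complex-valued forms on the mirror, of mixed degree. -/
abbrev CForm (n : ℕ) (Xc : Type*) [TopologicalSpace Xc] [ChartedSpace (Cpx n) Xc] : Type _ :=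
  ∀ p : Xc, Ext (TangentSpace 𝓘(ℂ, Cpx n) p)

/-- The expression of a form on the mirror in the coordinates `z = θ̌ + i r`. -/
def Mirror.rep (a : ι) (φ : CForm n Xc) (z : Cpx n) : Ext (Cpx n) :=
  let D : Cpx n →L[ℂ] TangentSpace 𝓘(ℂ, Cpx n) (M.par a z) :=
    mfderiv 𝓘(ℂ, Cpx n) 𝓘(ℂ, Cpx n) (M.par a) z
  pull (D.toLinearMap.restrictScalars ℝ) (φ (M.par a z))

/-- The domain of the coordinates `z = θ̌ + i r`. -/
def Mirror.dom (_M : Mirror S Xc) (a : ι) : Set (Cpx n) := {z | imPart z ∈ (S.chart a).target}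

theorem TorusBundle.isOpen_dom (S : TorusBundle n ι B X σ) (a : ι) : IsOpen (S.dom a) :=
  (S.chart a).open_target.preimage continuous_fst

theorem Mirror.isOpen_dom (a : ι) : IsOpen (M.dom a) :=
  (S.chart a).open_target.preimage
    (continuous_pi fun i => Complex.continuous_im.comp (continuous_apply i))

theorem TorusBundle.rep_add (S : TorusBundle n ι B X σ) (a : ι) (φ ψ : Form n X) :
    S.rep a (φ + ψ) = fun y => S.rep a φ y + S.rep a ψ y :=
  funext fun _ => map_add _ _ _

theorem TorusBundle.rep_smul (S : TorusBundle n ι B X σ) (a : ι) (c : ℂ) (φ : Form n X) :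
    S.rep a (c • φ) = fun y => c • S.rep a φ y :=
  funext fun _ => (pull _).toLinearMap.map_smul c _

theorem TorusBundle.rep_zero (S : TorusBundle n ι B X σ) (a : ι) :
    S.rep a (0 : Form n X) = fun _ => 0 :=
  funext fun _ => map_zero _

theorem Mirror.rep_add (a : ι) (φ ψ : CForm n Xc) :
    M.rep a (φ + ψ) = fun y => M.rep a φ y + M.rep a ψ y :=
  funext fun _ => map_add _ _ _

theorem Mirror.rep_smul (a : ι) (c : ℂ) (φ : CForm n Xc) :
    M.rep a (c • φ) = fun y => c • M.rep a φ y :=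
  funext fun _ => (pull _).toLinearMap.map_smul c _

theorem Mirror.rep_zero (a : ι) : M.rep a (0 : CForm n Xc) = fun _ => 0 :=
  funext fun _ => map_zero _

/-! ### Torus-invariant forms and the two cohomologies -/

/-- `Ω_B^*(X, ℂ)`: the smooth torus-invariant forms on `X`, that is, those with local expressions
`∑ a_IJ(r) dθ_I ∧ dr_J`, with coefficients depending on the base only. -/
def TorusBundle.invForms (S : TorusBundle n ι B X σ) : Submodule ℂ (Form n X) where
  carrier := {φ | ∀ a, SmoothOn (S.rep a φ) (S.dom a) ∧
    ∀ r ∈ (S.chart a).target, ∀ θ θ', S.rep a φ (r, θ) = S.rep a φ (r, θ')}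
  add_mem' {φ ψ} hφ hψ a := by
    rw [S.rep_add]
    refine ⟨(hφ a).1.add (hψ a).1, fun r hr θ θ' => ?_⟩
    simp only [(hφ a).2 r hr θ θ', (hψ a).2 r hr θ θ']
  zero_mem' a := by
    rw [S.rep_zero]
    exact ⟨SmoothOn.zero, fun _ _ _ _ => rfl⟩
  smul_mem' c φ hφ a := by
    rw [S.rep_smul]
    refine ⟨(hφ a).1.smul c, fun r hr θ θ' => ?_⟩
    simp only [(hφ a).2 r hr θ θ']

/-- `Ω_B^{(p,q)^Λ}(X)`: the torus-invariant forms with `p` fibre directions `dθ` and `q` base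
directions `dr`. -/
def TorusBundle.invFormsPQ (S : TorusBundle n ι B X σ) (p q : ℕ) : Submodule ℂ (Form n X) where
  carrier := {φ | φ ∈ S.invForms ∧ ∀ a, ∀ y ∈ S.dom a, S.rep a φ y ∈ bidegree dth dr p q}
  add_mem' {φ ψ} hφ hψ := ⟨add_mem hφ.1 hψ.1, fun a y hy => by
    rw [S.rep_add]
    exact add_mem (hφ.2 a y hy) (hψ.2 a y hy)⟩
  zero_mem' := ⟨zero_mem _, fun a y _ => by
    rw [S.rep_zero]
    exact zero_mem _⟩
  smul_mem' c φ hφ := ⟨Submodule.smul_mem _ c hφ.1, fun a y hy => by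
    rw [S.rep_smul]
    exact Submodule.smul_mem _ c (hφ.2 a y hy)⟩

/-- `Ker (d + d^Λ) ∩ Ω_B^{(p,q)^Λ}(X)`. -/
def TorusBundle.tyKer (S : TorusBundle n ι B X σ) (p q : ℕ) : Submodule ℂ (Form n X) where
  carrier := {φ | φ ∈ S.invFormsPQ p q ∧
    ∀ a, ∀ y ∈ S.dom a, dLoc (S.rep a φ) y + dLamLoc (S.rep a φ) y = 0}
  add_mem' {φ ψ} hφ hψ := ⟨add_mem hφ.1 hψ.1, fun a y hy => by
    rw [S.rep_add, dLoc_add (S.isOpen_dom a) (hφ.1.1 a).1 (hψ.1.1 a).1 hy,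
      dLamLoc_add (S.isOpen_dom a) (hφ.1.1 a).1 (hψ.1.1 a).1 hy, add_add_add_comm,
      hφ.2 a y hy, hψ.2 a y hy, add_zero]⟩
  zero_mem' := ⟨zero_mem _, fun a y _ => by
    rw [S.rep_zero]
    simp [dLamLoc, dLoc, partialD]⟩
  smul_mem' c φ hφ := ⟨Submodule.smul_mem _ c hφ.1, fun a y hy => by
    rw [S.rep_smul, dLoc_smul (S.isOpen_dom a) (hφ.1.1 a).1 c hy,
      dLamLoc_smul (S.isOpen_dom a) (hφ.1.1 a).1 c hy, ← smul_add, hφ.2 a y hy, smul_zero]⟩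

/-- `Im (d d^Λ) ∩ Ω_B^{(p,q)^Λ}(X)`, with `d d^Λ` acting on `Ω_B^*(X, ℂ)`. -/
def TorusBundle.tyIm (S : TorusBundle n ι B X σ) (p q : ℕ) : Submodule ℂ (Form n X) where
  carrier := {φ | φ ∈ S.invFormsPQ p q ∧ ∃ ψ ∈ S.invForms,
    ∀ a, ∀ y ∈ S.dom a, S.rep a φ y = dLoc (dLamLoc (S.rep a ψ)) y}
  add_mem' := by
    rintro φ φ' ⟨hφ, ψ, hψ, h⟩ ⟨hφ', ψ', hψ', h'⟩
    refine ⟨add_mem hφ hφ', ψ + ψ', add_mem hψ hψ', fun a y hy => ?_⟩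
    rw [S.rep_add, S.rep_add, dLoc_dLamLoc_add (S.isOpen_dom a) (hψ a).1 (hψ' a).1 hy,
      ← h a y hy, ← h' a y hy]
  zero_mem' := ⟨zero_mem _, 0, zero_mem _, fun a y _ => by
    rw [S.rep_zero]
    simp [dLamLoc, dLoc, partialD]⟩
  smul_mem' := by
    rintro c φ ⟨hφ, ψ, hψ, h⟩
    refine ⟨Submodule.smul_mem _ c hφ, c • ψ, Submodule.smul_mem _ c hψ, fun a y hy => ?_⟩
    rw [S.rep_smul, S.rep_smul, dLoc_dLamLoc_smul (S.isOpen_dom a) (hψ a).1 c hy, ← h a y hy]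

/-- The torus-invariant refined Tseng-Yau cohomology `H^{(p,q)^Λ}_{B, d + d^Λ}(X, ℂ)`. -/
abbrev TorusBundle.TsengYau (S : TorusBundle n ι B X σ) (p q : ℕ) : Type _ :=
  ↥(S.tyKer p q) ⧸ (S.tyIm p q).submoduleOf (S.tyKer p q)

/-- `Ω_B^*(X̌)`: the smooth torus-invariant forms on the mirror, that is, those with local
expressions `∑ a_IJ(r) dz_I ∧ d z̄_J`, with coefficients depending on the base only. -/
def Mirror.invForms : Submodule ℂ (CForm n Xc) where
  carrier := {φ | ∀ a, SmoothOn (M.rep a φ) (M.dom a) ∧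
    ∀ r ∈ (S.chart a).target, ∀ t t', M.rep a φ (mkCpx r t) = M.rep a φ (mkCpx r t')}
  add_mem' {φ ψ} hφ hψ a := by
    rw [M.rep_add]
    refine ⟨(hφ a).1.add (hψ a).1, fun r hr t t' => ?_⟩
    simp only [(hφ a).2 r hr t t', (hψ a).2 r hr t t']
  zero_mem' a := by
    rw [M.rep_zero]
    exact ⟨SmoothOn.zero, fun _ _ _ _ => rfl⟩
  smul_mem' c φ hφ a := by
    rw [M.rep_smul]
    refine ⟨(hφ a).1.smul c, fun r hr t t' => ?_⟩
    simp only [(hφ a).2 r hr t t']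

/-- `Ω_B^{p,q}(X̌)`: the torus-invariant `(p, q)`-forms on the mirror. -/
def Mirror.invFormsPQ (p q : ℕ) : Submodule ℂ (CForm n Xc) where
  carrier := {φ | φ ∈ M.invForms ∧ ∀ a, ∀ z ∈ M.dom a, M.rep a φ z ∈ bidegree dz dzbar p q}
  add_mem' {φ ψ} hφ hψ := ⟨add_mem hφ.1 hψ.1, fun a z hz => by
    rw [M.rep_add]
    exact add_mem (hφ.2 a z hz) (hψ.2 a z hz)⟩
  zero_mem' := ⟨zero_mem _, fun a z _ => by
    rw [M.rep_zero]
    exact zero_mem _⟩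
  smul_mem' c φ hφ := ⟨Submodule.smul_mem _ c hφ.1, fun a z hz => by
    rw [M.rep_smul]
    exact Submodule.smul_mem _ c (hφ.2 a z hz)⟩

/-- `Ker d ∩ Ω_B^{p,q}(X̌)`. -/
def Mirror.bcKer (p q : ℕ) : Submodule ℂ (CForm n Xc) where
  carrier := {φ | φ ∈ M.invFormsPQ p q ∧ ∀ a, ∀ z ∈ M.dom a, dCLoc (M.rep a φ) z = 0}
  add_mem' {φ ψ} hφ hψ := ⟨add_mem hφ.1 hψ.1, fun a z hz => by
    rw [M.rep_add, dCLoc_add (M.isOpen_dom a) (hφ.1.1 a).1 (hψ.1.1 a).1 hz,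
      hφ.2 a z hz, hψ.2 a z hz, add_zero]⟩
  zero_mem' := ⟨zero_mem _, fun a z _ => by
    rw [M.rep_zero]
    simp [dCLoc, partialD]⟩
  smul_mem' c φ hφ := ⟨Submodule.smul_mem _ c hφ.1, fun a z hz => by
    rw [M.rep_smul, dCLoc_smul (M.isOpen_dom a) (hφ.1.1 a).1 c hz, hφ.2 a z hz, smul_zero]⟩

/-- `Im (∂ ∂̄) ∩ Ω_B^{p,q}(X̌)`, with `∂ ∂̄` acting on `Ω_B^*(X̌)`. -/
def Mirror.bcIm (p q : ℕ) : Submodule ℂ (CForm n Xc) where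
  carrier := {φ | φ ∈ M.invFormsPQ p q ∧ ∃ ψ ∈ M.invForms,
    ∀ a, ∀ z ∈ M.dom a, M.rep a φ z = delLoc (delbarLoc (M.rep a ψ)) z}
  add_mem' := by
    rintro φ φ' ⟨hφ, ψ, hψ, h⟩ ⟨hφ', ψ', hψ', h'⟩
    refine ⟨add_mem hφ hφ', ψ + ψ', add_mem hψ hψ', fun a z hz => ?_⟩
    rw [M.rep_add, M.rep_add, delLoc_delbarLoc_add (M.isOpen_dom a) (hψ a).1 (hψ' a).1 hz,
      ← h a z hz, ← h' a z hz]
  zero_mem' := ⟨zero_mem _, 0, zero_mem _, fun a z _ => by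
    rw [M.rep_zero]
    simp [delLoc, delbarLoc, partialD]⟩
  smul_mem' := by
    rintro c φ ⟨hφ, ψ, hψ, h⟩
    refine ⟨Submodule.smul_mem _ c hφ, c • ψ, Submodule.smul_mem _ c hψ, fun a z hz => ?_⟩
    rw [M.rep_smul, M.rep_smul, delLoc_delbarLoc_smul (M.isOpen_dom a) (hψ a).1 c hz, ← h a z hz]

/-- The torus-invariant Bott-Chern cohomology `H^{p,q}_{B, B.C.}(X̌)`. -/
abbrev Mirror.BottChern (p q : ℕ) : Type _ :=
  ↥(M.bcKer p q) ⧸ (M.bcIm p q).submoduleOf (M.bcKer p q)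

/-- `φ` is the Fourier-Mukai transform of the torus-invariant form `φc` on the mirror. -/
def Mirror.IsFourierMukai (φc : CForm n Xc) (φ : Form n X) : Prop :=
  ∀ a, ∀ y ∈ S.dom a, S.rep a φ y = ftLoc (M.rep a φc) y

/-- `φc` is the Fourier-Mukai transform of the torus-invariant form `φ` on `X`. -/
def Mirror.IsFourierMukaiInv (φ : Form n X) (φc : CForm n Xc) : Prop :=
  ∀ a, ∀ z ∈ M.dom a, M.rep a φc z = ftInvLoc (S.rep a φ) z

end Geometry

end SemiFlat

end

/-!
The Fourier-Mukai transform of a torus-invariant form involves no genuine integration: the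
coefficients are constant along the torus fibres, so in semi-flat coordinates the transform is a
fixed linear map `ftLin` between exterior algebras, applied to the coefficient form over each point
of the base, and likewise `ftInvLin` in the other direction.

These linear maps are fermionic Fourier transforms (`IsFourier`).  As the contraction of
`exp (∑ dθ̌_i ∧ dθ_i)` with a fibre direction is its product with a dual covector, `ftLin` turns
multiplication by `dz_i` into contraction with `∂/∂θ_i`, contraction with `∂/∂z_i` into
multiplication by `dθ_i`, and multiplication by `d z̄_i` into multiplication by `dr_i`, up to signs
depending on `n` only; moreover `ftLin 1` is a multiple of `dθ_1 ∧ ⋯ ∧ dθ_n`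
(`isFourier_fiberTransform`).  These relations determine the transform on products of covectors,
and they give all of its algebraic properties:

* `ftLin` and `ftInvLin` are inverse to each other up to a nonzero constant
  (`IsFourier.inversion`);
* bidegree `(p, q)` corresponds to bidegree `(n - p, q)` (`IsFourier.map_mem_bideg`);
* `ftLin` commutes with the changes of coordinates given by `A ∈ SL(n, ℤ)`, where `det A = 1` is
  needed for the volume form of the fibre (`ftLin_pull`).

For invariant forms `d = ∑ dr_i ∧ ∂/∂r_i`, `d^Λ = ∑ ι_{∂/∂θ_i} ∂/∂r_i`, and `∂`, `∂̄` are, up to the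
constants `∓ i/2`, the operators `∑ dz_i ∧ ∂/∂r_i` and `∑ d z̄_i ∧ ∂/∂r_i`.  So the transform takes
both `∂` to `d^Λ` and `∂̄` to `d` with one and the same constant: `d = ∂ + ∂̄` on the mirror goes to
a multiple of `d + d^Λ` (`ftLin_dCLoc`), and `∂ ∂̄` to a multiple of `d^Λ d = - d d^Λ`
(`ftLin_delLoc_delbarLoc`).

For the global statement, the differentials of the changes of coordinates on `X` and on the mirror
are given by the same matrices `A` (`TorusBundle.exists_linearPart`, `Mirror.parDeriv_eq`), so the
local transforms of an invariant form glue (`Mirror.exists_isFourierMukai`,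
`Mirror.exists_isFourierMukaiInv`).  The resulting bijection of invariant forms identifies cocycles
with cocycles (`Mirror.IsFourierMukai.mem_bcKer_iff`) and coboundaries with coboundaries
(`Mirror.IsFourierMukai.mem_bcIm_iff`).
-/

noncomputable section

namespace SemiFlat

/-! ### Contractions on an exterior algebra -/

section Contraction

variable {W U W' : Type*} [AddCommGroup W] [Module ℂ W] [AddCommGroup U] [Module ℂ U]
  [AddCommGroup W'] [Module ℂ W']

open ExteriorAlgebra (ι)

/-- Interior product with a functional on the generating space. -/
abbrev contr (d : Module.Dual ℂ W) : ExteriorAlgebra ℂ W →ₗ[ℂ] ExteriorAlgebra ℂ W :=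
  CliffordAlgebra.contractLeft d

theorem ι_mul_swap (x y : W) : ι ℂ x * ι ℂ y = -(ι ℂ y * ι ℂ x) :=
  eq_neg_of_add_eq_zero_left (ExteriorAlgebra.ι_add_mul_swap x y)

theorem contr_ι_mul (d : Module.Dual ℂ W) (α : W) (x : ExteriorAlgebra ℂ W) :
    contr d (ι ℂ α * x) = d α • x - ι ℂ α * contr d x :=
  CliffordAlgebra.contractLeft_ι_mul d α x

theorem contr_one (d : Module.Dual ℂ W) : contr d (1 : ExteriorAlgebra ℂ W) = 0 :=
  CliffordAlgebra.contractLeft_one _ d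

/-- To prove a linear identity of forms, it suffices to treat `1` and left multiplication by
covectors. -/
theorem linearMap_ext_of_ι_mul {F G : ExteriorAlgebra ℂ W →ₗ[ℂ] ExteriorAlgebra ℂ W'}
    (h1 : F 1 = G 1) (s : Set W) (hs : Submodule.span ℂ s = ⊤)
    (h : ∀ α ∈ s, ∀ x, F x = G x → F (ι ℂ α * x) = G (ι ℂ α * x)) (x : ExteriorAlgebra ℂ W) :
    F x = G x := by
  induction x using CliffordAlgebra.left_induction with
  | algebraMap r => rw [Algebra.algebraMap_eq_smul_one, map_smul, map_smul, h1]
  | add x y hx hy => rw [map_add, map_add, hx, hy]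
  | ι_mul x m hx =>
    have hm : m ∈ Submodule.span ℂ s := hs ▸ Submodule.mem_top
    change F (ι ℂ m * x) = G (ι ℂ m * x)
    induction hm using Submodule.span_induction with
    | mem α hα => exact h α hα x hx
    | zero => simp
    | add α β _ _ hα hβ => rw [map_add, add_mul, map_add, map_add, hα, hβ]
    | smul c α _ hα => rw [map_smul, smul_mul_assoc, map_smul, map_smul, hα]

/-- Contraction is natural for the maps induced by linear maps of the generators. -/
theorem contr_map (f : W →ₗ[ℂ] W') (d : Module.Dual ℂ W') (x : ExteriorAlgebra ℂ W) :
    contr d (ExteriorAlgebra.map f x) = ExteriorAlgebra.map f (contr (d ∘ₗ f) x) := by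
  refine linearMap_ext_of_ι_mul (F := contr d ∘ₗ (ExteriorAlgebra.map f).toLinearMap)
    (G := (ExteriorAlgebra.map f).toLinearMap ∘ₗ contr (d ∘ₗ f)) ?_ Set.univ (by simp) ?_ x
  · simp
  · intro α _ x hx
    simp only [LinearMap.comp_apply, AlgHom.toLinearMap_apply] at hx ⊢
    rw [map_mul, ExteriorAlgebra.map_apply_ι, contr_ι_mul, contr_ι_mul, map_sub, map_smul, map_mul,
      ExteriorAlgebra.map_apply_ι, hx]
    rfl

/-- The graded Leibniz rule; the sign is the grading involution of the first factor. -/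
theorem contr_mul (d : Module.Dual ℂ W) (x y : ExteriorAlgebra ℂ W) :
    contr d (x * y) = contr d x * y + CliffordAlgebra.involute x * contr d y := by
  refine linearMap_ext_of_ι_mul (F := contr d ∘ₗ LinearMap.mulRight ℂ y)
    (G := LinearMap.mulRight ℂ y ∘ₗ contr d +
      LinearMap.mulRight ℂ (contr d y) ∘ₗ CliffordAlgebra.involute.toLinearMap) ?_ Set.univ
      (by simp) ?_ x
  · simp
  · intro α _ x hx
    simp only [LinearMap.comp_apply, LinearMap.add_apply, LinearMap.mulRight_apply,
      AlgHom.toLinearMap_apply] at hx ⊢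
    have h : CliffordAlgebra.involute (ι ℂ α * x) = -ι ℂ α * CliffordAlgebra.involute x := by
      rw [map_mul]
      exact congrArg (· * _) (CliffordAlgebra.involute_ι α)
    rw [mul_assoc, contr_ι_mul, contr_ι_mul, hx, h]
    simp only [sub_mul, mul_add, mul_assoc, smul_mul_assoc, neg_mul]
    abel

/-- Moving a covector past a form costs the grading involution. -/
theorem involute_mul_ι (α : W) (x : ExteriorAlgebra ℂ W) :
    CliffordAlgebra.involute x * ι ℂ α = ι ℂ α * x := by
  refine linearMap_ext_of_ι_mul
    (F := LinearMap.mulRight ℂ (ι ℂ α) ∘ₗ CliffordAlgebra.involute.toLinearMap)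
    (G := LinearMap.mulLeft ℂ (ι ℂ α)) ?_ Set.univ (by simp) ?_ x
  · simp
  · intro β _ x hx
    simp only [LinearMap.comp_apply, LinearMap.mulRight_apply, LinearMap.mulLeft_apply,
      AlgHom.toLinearMap_apply] at hx ⊢
    have h : CliffordAlgebra.involute (ι ℂ β * x) = -ι ℂ β * CliffordAlgebra.involute x := by
      rw [map_mul]
      exact congrArg (· * _) (CliffordAlgebra.involute_ι β)
    rw [h, mul_assoc, hx, ← mul_assoc, ← mul_assoc, ι_mul_swap α β, neg_mul, neg_mul]

/-- Iterated contraction; the first functional of the list acts first. -/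
def contrList : List (Module.Dual ℂ W) → (ExteriorAlgebra ℂ W →ₗ[ℂ] ExteriorAlgebra ℂ W)
  | [] => LinearMap.id
  | d :: l => contrList l ∘ₗ contr d

theorem contrList_ι_mul (l : List (Module.Dual ℂ W)) (α : W) (h : ∀ d ∈ l, d α = 0)
    (x : ExteriorAlgebra ℂ W) :
    contrList l (ι ℂ α * x) = (-1 : ℂ) ^ l.length • (ι ℂ α * contrList l x) := by
  induction l generalizing x with
  | nil => simp [contrList]
  | cons d l ih =>
    simp only [List.mem_cons, forall_eq_or_imp] at h
    simp only [contrList, LinearMap.comp_apply]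
    rw [contr_ι_mul, h.1, zero_smul, zero_sub, map_neg, ih h.2, List.length_cons, pow_succ]
    simp

theorem contrList_contr (l : List (Module.Dual ℂ W)) (d : Module.Dual ℂ W)
    (x : ExteriorAlgebra ℂ W) :
    contrList l (contr d x) = (-1 : ℂ) ^ l.length • contr d (contrList l x) := by
  induction l generalizing x with
  | nil => simp [contrList]
  | cons d' l ih =>
    simp only [contrList, LinearMap.comp_apply]
    rw [contr, CliffordAlgebra.contractLeft_comm, map_neg, ih, List.length_cons, pow_succ]
    simp

theorem contrList_contr_of_mem {l : List (Module.Dual ℂ W)} {d : Module.Dual ℂ W} (h : d ∈ l)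
    (x : ExteriorAlgebra ℂ W) : contrList l (contr d x) = 0 := by
  induction l generalizing x with
  | nil => simp at h
  | cons d' l ih =>
    simp only [contrList, LinearMap.comp_apply]
    rcases List.mem_cons.1 h with rfl | h
    · rw [contr, CliffordAlgebra.contractLeft_contractLeft, map_zero]
    · rw [contr, CliffordAlgebra.contractLeft_comm, map_neg, ih h, neg_zero]

/-- If every contraction `v i` multiplies `E` by the covector `κ i`, then the iterated contraction
multiplies `E` by the product of these covectors, up to sign. -/
theorem contrList_eq_prod_mul {J : Type*} (l : List J) (v : J → Module.Dual ℂ W) (κ : J → W)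
    (hv : ∀ i j, v i (κ j) = 0) (E : ExteriorAlgebra ℂ W)
    (hE : ∀ i, contr (v i) E = ι ℂ (κ i) * E) :
    ∃ s : ℂ, s ≠ 0 ∧ contrList (l.map v) E = s • ((l.map fun i => ι ℂ (κ i)).prod * E) := by
  induction l with
  | nil => exact ⟨1, one_ne_zero, by simp [contrList]⟩
  | cons i l ih =>
    obtain ⟨s, hs, h⟩ := ih
    refine ⟨(-1) ^ l.length * s, mul_ne_zero (pow_ne_zero _ (by simp)) hs, ?_⟩
    simp only [List.map_cons, contrList, LinearMap.comp_apply, List.prod_cons]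
    have hi : ∀ d ∈ l.map v, d (κ i) = 0 := by
      simp only [List.mem_map]
      rintro d ⟨j, _, rfl⟩
      exact hv j i
    rw [hE, contrList_ι_mul _ _ hi, h, List.length_map, mul_smul, mul_smul_comm, mul_assoc]

/-- Contraction of a product of covectors with the dual functionals, in the reverse order. -/
theorem foldr_contr_prod {J : Type*} {l : List J} (hl : l.Nodup) (δ : J → Module.Dual ℂ W)
    (a : J → W) (h1 : ∀ i, δ i (a i) = 1) (h0 : ∀ i j, i ≠ j → δ i (a j) = 0) :
    ∃ s : ℂ, s ≠ 0 ∧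
      l.foldr (fun i x => contr (δ i) x) (l.map fun i => ι ℂ (a i)).prod = s • 1 := by
  -- a covector killed by all the functionals moves past the contractions up to sign
  have key : ∀ (l : List J) (α : W), (∀ i ∈ l, δ i α = 0) → ∀ x,
      l.foldr (fun i x => contr (δ i) x) (ι ℂ α * x) =
        (-1 : ℂ) ^ l.length • (ι ℂ α * l.foldr (fun i x => contr (δ i) x) x) := by
    intro l α hα x
    induction l with
    | nil => simp
    | cons i l ih =>
      simp only [List.mem_cons, forall_eq_or_imp] at hα
      rw [List.foldr_cons, ih hα.2, map_smul, contr_ι_mul, hα.1, List.foldr_cons,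
        List.length_cons, pow_succ]
      simp
  induction l with
  | nil => exact ⟨1, one_ne_zero, by simp⟩
  | cons i l ih =>
    obtain ⟨hi, hl⟩ := List.nodup_cons.1 hl
    obtain ⟨s, hs, h⟩ := ih hl
    refine ⟨(-1) ^ l.length * s, mul_ne_zero (pow_ne_zero _ (by simp)) hs, ?_⟩
    rw [List.map_cons, List.prod_cons, List.foldr_cons,
      key l _ (fun j hj => h0 j i fun e => hi (e ▸ hj)), h, map_smul, contr_ι_mul, h1, map_smul,
      contr_one]
    simp [mul_smul]

end Contraction

/-! ### The exponential of a two-form -/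

section Exponential

variable {U : Type*} [AddCommGroup U] [Module ℂ U]

open ExteriorAlgebra (ι)

/-- The exponential series of `K`, cut off after the term of order `n`. -/
def truncExp (n : ℕ) (K : ExteriorAlgebra ℂ U) : ExteriorAlgebra ℂ U :=
  ∑ m ∈ Finset.range (n + 1), ((m.factorial : ℂ)⁻¹) • K ^ m

/-- Products of two covectors are central. -/
theorem ι_commute_ι_mul_ι (x y z : U) : Commute (ι ℂ x) (ι ℂ y * ι ℂ z) := by
  have h : ι ℂ x * (ι ℂ y * ι ℂ z) = ι ℂ y * ι ℂ z * ι ℂ x := by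
    rw [← mul_assoc, ι_mul_swap x y, neg_mul, mul_assoc, ι_mul_swap x z, mul_neg, neg_neg,
      mul_assoc]
  exact h

theorem ι_commute_sum {J : Type*} (s : Finset J) (a b : J → U) (x : U) :
    Commute (ι ℂ x) (∑ i ∈ s, ι ℂ (a i) * ι ℂ (b i)) :=
  Commute.sum_right _ _ _ fun i _ => ι_commute_ι_mul_ι x (a i) (b i)

/-- A sum of `n` products of two covectors has vanishing power `n + 1`. -/
theorem sum_ι_mul_ι_pow_eq_zero {J : Type*} (s : Finset J) (a b : J → U) :
    (∑ i ∈ s, ι ℂ (a i) * ι ℂ (b i)) ^ (s.card + 1) = 0 := by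
  classical
  induction s using Finset.induction_on with
  | empty => simp
  | insert i s hi ih =>
    rw [Finset.sum_insert hi, Finset.card_insert_of_notMem hi]
    refine Commute.add_pow_eq_zero_of_add_le_succ_of_pow_eq_zero (m := 2) (n := s.card + 1)
      ((ι_commute_sum s a b (a i)).mul_left (ι_commute_sum s a b (b i))) ?_ ih (by omega)
    rw [pow_two, mul_assoc, ← mul_assoc (ι ℂ (b i)), ι_mul_swap (b i), neg_mul, mul_assoc,
      ExteriorAlgebra.ι_sq_zero]
    simp

/-- A contraction acts on the exponential of `K` as multiplication by the contraction of `K`. -/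
theorem contr_truncExp {n : ℕ} (a b : Fin n → U) (d : Module.Dual ℂ U) (κ : U)
    (hκ : ∑ i, (d (a i) • b i - d (b i) • a i) = κ) :
    contr d (truncExp n (∑ i, ι ℂ (a i) * ι ℂ (b i))) =
      ι ℂ κ * truncExp n (∑ i, ι ℂ (a i) * ι ℂ (b i)) := by
  have hK : contr d (∑ i, ι ℂ (a i) * ι ℂ (b i)) = ι ℂ κ := by
    rw [map_sum, ← hκ, map_sum]
    refine Finset.sum_congr rfl fun i _ => ?_
    rw [contr_ι_mul, contr, map_sub, map_smul, map_smul]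
    congr 1
    erw [CliffordAlgebra.contractLeft_ι]
    rw [Algebra.algebraMap_eq_smul_one, mul_smul_comm, mul_one]
  have hinv : CliffordAlgebra.involute (∑ i, ι ℂ (a i) * ι ℂ (b i)) =
      ∑ i, ι ℂ (a i) * ι ℂ (b i) := by
    rw [map_sum]
    refine Finset.sum_congr rfl fun i _ => ?_
    rw [map_mul]
    erw [CliffordAlgebra.involute_ι, CliffordAlgebra.involute_ι]
    rw [neg_mul_neg]
  have hc : Commute (ι ℂ κ) (∑ i, ι ℂ (a i) * ι ℂ (b i)) := ι_commute_sum _ a b κ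
  have h0 := sum_ι_mul_ι_pow_eq_zero Finset.univ a b
  rw [Finset.card_univ, Fintype.card_fin] at h0
  generalize (∑ i, ι ℂ (a i) * ι ℂ (b i)) = K at *
  have hpow : ∀ m : ℕ, contr d (K ^ (m + 1)) = ((m + 1 : ℕ) : ℂ) • (ι ℂ κ * K ^ m) := by
    intro m
    induction m with
    | zero => simp [hK]
    | succ m ih =>
      rw [pow_succ' K (m + 1), contr_mul, hK, ih, hinv, mul_smul_comm, ← mul_assoc, ← hc.eq,
        mul_assoc, ← pow_succ']
      push_cast
      module
  -- contracting `K ^ (n + 1) = 0` shows that the last term of the product with `κ` vanishes too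
  have hlast : ι ℂ κ * K ^ n = 0 := by
    have h := hpow n
    rw [h0, map_zero, eq_comm, smul_eq_zero] at h
    exact h.resolve_left (Nat.cast_ne_zero.2 n.succ_ne_zero)
  rw [truncExp, map_sum, Finset.sum_range_succ', Finset.mul_sum, Finset.sum_range_succ]
  rw [mul_smul_comm, hlast, smul_zero, map_smul, pow_zero, contr_one, smul_zero]
  congr 1
  refine Finset.sum_congr rfl fun m _ => ?_
  rw [map_smul, hpow, smul_smul, mul_smul_comm, Nat.factorial_succ]
  congr 1
  have : ((m : ℂ) + 1) ≠ 0 := Nat.cast_add_one_ne_zero m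
  push_cast
  field_simp

theorem map_truncExp_eq_one {W : Type*} [AddCommGroup W] [Module ℂ W] (n : ℕ) (H : U →ₗ[ℂ] W)
    {K : ExteriorAlgebra ℂ U} (hK : ExteriorAlgebra.map H K = 0) :
    ExteriorAlgebra.map H (truncExp n K) = 1 := by
  simp [truncExp, Finset.sum_range_succ', hK]

end Exponential

/-! ### Fourier transforms between exterior algebras -/

section Fourier

variable {W U W' : Type*} [AddCommGroup W] [Module ℂ W] [AddCommGroup U] [Module ℂ U]
  [AddCommGroup W'] [Module ℂ W'] {n : ℕ}

open ExteriorAlgebra (ι)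

/-- The algebraic properties of the Fourier transform along a torus of dimension `n`: it exchanges
multiplication by the fibre covectors `a i` with contraction by the dual fibre directions `δ' i`,
and contraction by the fibre directions `δ i` with multiplication by the dual fibre covectors
`a' i`, it takes the base covectors `b i` to `b' i`, and it sends `1` to a multiple of the
volume form of the dual fibre. -/
structure IsFourier (F : ExteriorAlgebra ℂ W →ₗ[ℂ] ExteriorAlgebra ℂ W') (a b : Fin n → W)
    (δ : Fin n → Module.Dual ℂ W) (a' b' : Fin n → W') (δ' : Fin n → Module.Dual ℂ W') :
    Prop where
  map_fiber_mul : ∀ i x, F (ι ℂ (a i) * x) = -(-1 : ℂ) ^ n • contr (δ' i) (F x)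
  map_base_mul : ∀ i x, F (ι ℂ (b i) * x) = (-1 : ℂ) ^ n • (ι ℂ (b' i) * F x)
  map_contr : ∀ i x, F (contr (δ i) x) = -(-1 : ℂ) ^ n • (ι ℂ (a' i) * F x)
  map_one : ∃ s : ℂ, s ≠ 0 ∧ F 1 = s • ((List.finRange n).map fun i => ι ℂ (a' i)).prod

/-- Pull back along `G`, multiply by the kernel `E`, contract with the fibre directions `v` and
restrict along `H`. -/
def fiberTransform (G : W →ₗ[ℂ] U) (H : U →ₗ[ℂ] W') (v : Fin n → Module.Dual ℂ U)
    (E : ExteriorAlgebra ℂ U) : ExteriorAlgebra ℂ W →ₗ[ℂ] ExteriorAlgebra ℂ W' :=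
  (ExteriorAlgebra.map H).toLinearMap ∘ₗ contrList ((List.finRange n).map v) ∘ₗ
    LinearMap.mulRight ℂ E ∘ₗ (ExteriorAlgebra.map G).toLinearMap

theorem fiberTransform_apply (G : W →ₗ[ℂ] U) (H : U →ₗ[ℂ] W') (v : Fin n → Module.Dual ℂ U)
    (E : ExteriorAlgebra ℂ U) (x : ExteriorAlgebra ℂ W) :
    fiberTransform G H v E x = ExteriorAlgebra.map H
      (contrList ((List.finRange n).map v) (ExteriorAlgebra.map G x * E)) := rfl

/-- A fibre transform with kernel `exp K`, `K = ∑ A i ∧ B i`, is a Fourier transform as soon as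
contraction of `K` with the directions `v i` of integration gives the dual fibre covectors, and
contraction with the dual directions `w i` gives back the fibre covectors. -/
theorem isFourier_fiberTransform {G : W →ₗ[ℂ] U} {H : U →ₗ[ℂ] W'} {v w : Fin n → Module.Dual ℂ U}
    {A B κ : Fin n → U} {a b : Fin n → W} {δ : Fin n → Module.Dual ℂ W} {a' b' : Fin n → W'}
    {δ' : Fin n → Module.Dual ℂ W'}
    (hκ : ∀ i, ∑ j, (v i (A j) • B j - v i (B j) • A j) = κ i)
    (hvκ : ∀ i j, v i (κ j) = 0) (hHκ : ∀ i, H (κ i) = a' i) (hvG : ∀ i, v i ∘ₗ G = δ i)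
    (hw : ∀ i, ∑ j, (w i (A j) • B j - w i (B j) • A j) = -G (a i))
    (hwG : ∀ i, w i ∘ₗ G = 0) (hwH : ∀ i, δ' i ∘ₗ H = w i)
    (hvb : ∀ i j, v i (G (b j)) = 0) (hb : ∀ i, H (G (b i)) = b' i)
    (hK : ∀ i, ι ℂ (H (A i)) * ι ℂ (H (B i)) = 0) :
    IsFourier (fiberTransform G H v (truncExp n (∑ i, ι ℂ (A i) * ι ℂ (B i)))) a b δ a' b' δ' := by
  have hEv := fun i => contr_truncExp A B (v i) (κ i) (hκ i)
  have hEw := fun i => contr_truncExp A B (w i) _ (hw i)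
  have hE1 : ExteriorAlgebra.map H (truncExp n (∑ i, ι ℂ (A i) * ι ℂ (B i))) = 1 := by
    refine map_truncExp_eq_one n H ?_
    simp only [map_sum, map_mul, ExteriorAlgebra.map_apply_ι, hK, Finset.sum_const_zero]
  generalize truncExp n (∑ i, ι ℂ (A i) * ι ℂ (B i)) = E at *
  constructor
  · intro i x
    -- contraction with `w i` annihilates the pulled back form and hits the kernel only
    have h : ExteriorAlgebra.map G (ι ℂ (a i) * x) * E =
        -contr (w i) (ExteriorAlgebra.map G x * E) := by
      rw [contr_mul, hEw, contr_map, hwG, ← mul_assoc, involute_mul_ι, map_mul,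
        ExteriorAlgebra.map_apply_ι]
      simp [contr]
    rw [fiberTransform_apply, h, map_neg, contrList_contr, fiberTransform_apply, contr_map, hwH]
    simp
  · intro i x
    have h : ExteriorAlgebra.map G (ι ℂ (b i) * x) * E =
        ι ℂ (G (b i)) * (ExteriorAlgebra.map G x * E) := by
      rw [map_mul, ExteriorAlgebra.map_apply_ι, mul_assoc]
    rw [fiberTransform_apply, h, contrList_ι_mul, map_smul, map_mul,
      ExteriorAlgebra.map_apply_ι, hb, fiberTransform_apply]
    · simp
    · simp only [List.mem_map]
      rintro d ⟨j, _, rfl⟩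
      exact hvb j i
  · intro i x
    -- the iterated contraction of the first term on the right repeats `v i`, so it vanishes
    have h : ExteriorAlgebra.map G (contr (δ i) x) * E =
        contr (v i) (ExteriorAlgebra.map G x * E) - ι ℂ (κ i) * (ExteriorAlgebra.map G x * E) := by
      rw [contr_mul, hEv, contr_map, hvG, ← mul_assoc, involute_mul_ι, mul_assoc,
        add_sub_cancel_right]
    rw [fiberTransform_apply, h, map_sub,
      contrList_contr_of_mem (List.mem_map_of_mem (List.mem_finRange i)), contrList_ι_mul,
      zero_sub, map_neg, map_smul, map_mul, ExteriorAlgebra.map_apply_ι, hHκ,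
      fiberTransform_apply]
    · simp
    · simp only [List.mem_map]
      rintro d ⟨j, _, rfl⟩
      exact hvκ j i
  · obtain ⟨s, hs, h⟩ := contrList_eq_prod_mul (List.finRange n) v κ hvκ E hEv
    refine ⟨s, hs, ?_⟩
    rw [fiberTransform_apply, map_one, one_mul, h, map_smul, map_mul, hE1, mul_one, map_list_prod,
      List.map_map]
    congr 3
    funext i
    simp [hHκ]

variable {F : ExteriorAlgebra ℂ W →ₗ[ℂ] ExteriorAlgebra ℂ W'}
  {F' : ExteriorAlgebra ℂ W' →ₗ[ℂ] ExteriorAlgebra ℂ W} {a b : Fin n → W}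
  {δ : Fin n → Module.Dual ℂ W} {a' b' : Fin n → W'} {δ' : Fin n → Module.Dual ℂ W'}

theorem neg_one_pow_smul_smul {V : Type*} [AddCommGroup V] [Module ℂ V] (n : ℕ) (x : V) :
    (-1 : ℂ) ^ n • (-1 : ℂ) ^ n • x = x := by
  rw [smul_smul, ← mul_pow]
  simp

/-- Fourier inversion: the composite commutes with multiplication by all covectors, so it is
multiplication by its value at `1`, which is the full contraction of the volume form. -/
theorem IsFourier.inversion (hF : IsFourier F a b δ a' b' δ') (hF' : IsFourier F' a' b' δ' a b δ)
    (h1 : ∀ i, δ i (a i) = 1) (h0 : ∀ i j, i ≠ j → δ i (a j) = 0)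
    (hspan : Submodule.span ℂ (Set.range a ∪ Set.range b) = ⊤) :
    ∃ c : ℂ, c ≠ 0 ∧ ∀ x, F' (F x) = c • x := by
  have hone : ∃ c : ℂ, c ≠ 0 ∧ F' (F 1) = c • 1 := by
    obtain ⟨s, hs, h⟩ := hF.map_one
    obtain ⟨s', hs', h'⟩ := hF'.map_one
    obtain ⟨c, hc, hc'⟩ := foldr_contr_prod (List.nodup_finRange n) δ a h1 h0
    -- `F'` turns the volume form `F 1` into an iterated contraction of the volume form `F' 1`
    have key : ∀ l : List (Fin n), F' (l.map fun i => ι ℂ (a' i)).prod =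
        (-(-1 : ℂ) ^ n) ^ l.length • l.foldr (fun i x => contr (δ i) x) (F' 1) := by
      intro l
      induction l with
      | nil => simp
      | cons i l ih =>
        rw [List.map_cons, List.prod_cons, hF'.map_fiber_mul, ih, map_smul, List.foldr_cons,
          List.length_cons, pow_succ', mul_smul]
    have hsmul : ∀ (l : List (Fin n)) (t : ℂ) (x : ExteriorAlgebra ℂ W),
        l.foldr (fun i x => contr (δ i) x) (t • x) =
          t • l.foldr (fun i x => contr (δ i) x) x := by
      intro l t x
      induction l with
      | nil => rfl
      | cons i l ih => rw [List.foldr_cons, ih, map_smul, List.foldr_cons]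
    refine ⟨s * ((-(-1 : ℂ) ^ n) ^ (List.finRange n).length * (s' * c)), ?_, ?_⟩
    · exact mul_ne_zero hs (mul_ne_zero (pow_ne_zero _ (neg_ne_zero.2 (pow_ne_zero _ (by simp))))
        (mul_ne_zero hs' hc))
    · rw [h, map_smul, key, h', hsmul, hc', mul_smul, mul_smul, mul_smul]
  obtain ⟨c, hc, hone⟩ := hone
  refine ⟨c, hc, linearMap_ext_of_ι_mul (F := F' ∘ₗ F) (G := c • LinearMap.id) hone _ hspan ?_⟩
  rintro α (⟨i, rfl⟩ | ⟨i, rfl⟩) x hx <;>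
    simp only [LinearMap.comp_apply, LinearMap.smul_apply, LinearMap.id_apply] at hx ⊢
  · rw [hF.map_fiber_mul, map_smul, hF'.map_contr, hx, neg_smul, neg_smul, smul_neg, neg_neg,
      neg_one_pow_smul_smul, mul_smul_comm]
  · rw [hF.map_base_mul, map_smul, hF'.map_base_mul, hx, neg_one_pow_smul_smul, mul_smul_comm]

/-- The span of the products of `p` covectors from the family `a` and `q` from the family `b`; this
is `bidegree` for an arbitrary generating space. -/
def bideg (a b : Fin n → W) (p q : ℕ) : Submodule ℂ (ExteriorAlgebra ℂ W) :=
  Submodule.span ℂ (Set.range fun i => ι ℂ (a i)) ^ p *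
    Submodule.span ℂ (Set.range fun i => ι ℂ (b i)) ^ q

/-- An induction principle for membership in the powers of a span. -/
theorem pow_span_induction {R : Type*} [Ring R] [Algebra ℂ R] {J : Type*} (s : J → R)
    {P : ℕ → R → Prop} (zero : ∀ k, P k 0) (add : ∀ k x y, P k x → P k y → P k (x + y))
    (smul : ∀ k (c : ℂ) x, P k x → P k (c • x)) (one : P 0 1)
    (mul : ∀ k i x, x ∈ Submodule.span ℂ (Set.range s) ^ k → P k x → P (k + 1) (s i * x))
    (k : ℕ) (x : R) (hx : x ∈ Submodule.span ℂ (Set.range s) ^ k) : P k x := by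
  induction k generalizing x with
  | zero =>
    rw [pow_zero] at hx
    obtain ⟨c, rfl⟩ := Submodule.mem_one.1 hx
    rw [Algebra.algebraMap_eq_smul_one]
    exact smul _ _ _ one
  | succ k ih =>
    rw [pow_succ'] at hx
    refine Submodule.mul_induction_on hx (fun y hy z hz => ?_) (add _)
    induction hy using Submodule.span_induction with
    | mem y hy =>
      obtain ⟨i, rfl⟩ := hy
      exact mul _ _ _ hz (ih z hz)
    | zero => rw [zero_mul]; exact zero _
    | add y y' _ _ h h' => rw [add_mul]; exact add _ _ _ h h'
    | smul c y _ h => rw [smul_mul_assoc]; exact smul _ _ _ h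

theorem ι_mul_mem_bideg_left (a b : Fin n → W) {p q : ℕ} (i : Fin n) {x : ExteriorAlgebra ℂ W}
    (hx : x ∈ bideg a b p q) : ι ℂ (a i) * x ∈ bideg a b (p + 1) q := by
  rw [bideg, pow_succ', mul_assoc]
  exact Submodule.mul_mem_mul (Submodule.subset_span ⟨i, rfl⟩) hx

theorem ι_mul_mem_bideg_right (a b : Fin n → W) {p q : ℕ} (i : Fin n) {x : ExteriorAlgebra ℂ W}
    (hx : x ∈ bideg a b p q) : ι ℂ (b i) * x ∈ bideg a b p (q + 1) := by
  refine Submodule.mul_induction_on hx (fun y hy z hz => ?_) fun y z hy hz => ?_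
  · have h : ι ℂ (b i) * y = (-1 : ℂ) ^ p • (y * ι ℂ (b i)) := by
      refine pow_span_induction (fun i => ι ℂ (a i))
        (P := fun k y => ι ℂ (b i) * y = (-1 : ℂ) ^ k • (y * ι ℂ (b i)))
        (by simp) ?_ ?_ (by simp) ?_ p y hy
      · intro k x y hx hy
        rw [mul_add, hx, hy, add_mul, smul_add]
      · intro k c x hx
        rw [mul_smul_comm, hx, smul_mul_assoc, smul_comm]
      · intro k j x _ hx
        rw [← mul_assoc, ι_mul_swap, neg_mul, mul_assoc, hx, pow_succ]
        simp [mul_assoc]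
    rw [← mul_assoc, h, smul_mul_assoc, mul_assoc, bideg, pow_succ']
    exact Submodule.smul_mem _ _ (Submodule.mul_mem_mul hy
      (Submodule.mul_mem_mul (Submodule.subset_span ⟨i, rfl⟩) hz))
  · rw [mul_add]
    exact add_mem hy hz

/-- Contraction with a functional that vanishes on the family `b` lowers the degree in the
family `a`. -/
theorem contr_mem_bideg (a b : Fin n → W) (d : Module.Dual ℂ W) (hb : ∀ i, d (b i) = 0)
    {p q : ℕ} {x : ExteriorAlgebra ℂ W} (hx : x ∈ bideg a b (p + 1) q) :
    contr d x ∈ bideg a b p q := by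
  have hbz : ∀ z ∈ Submodule.span ℂ (Set.range fun i => ι ℂ (b i)) ^ q, contr d z = 0 := by
    refine pow_span_induction (fun i => ι ℂ (b i)) (P := fun _ z => contr d z = 0)
      (by simp) ?_ ?_ (contr_one d) ?_ q
    · intro k x y hx hy
      rw [map_add, hx, hy, add_zero]
    · intro k c x hx
      rw [map_smul, hx, smul_zero]
    · intro k j x _ hx
      rw [contr_ι_mul, hb, hx, zero_smul, mul_zero, sub_zero]
  -- degree zero is stated separately, because of the truncated subtraction `k - 1`
  have haz : ∀ k, ∀ y ∈ Submodule.span ℂ (Set.range fun i => ι ℂ (a i)) ^ k,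
      (k = 0 → contr d y = 0) ∧
        contr d y ∈ Submodule.span ℂ (Set.range fun i => ι ℂ (a i)) ^ (k - 1) := by
    refine pow_span_induction (fun i => ι ℂ (a i)) (P := fun k y => (k = 0 → contr d y = 0) ∧
        contr d y ∈ Submodule.span ℂ (Set.range fun i => ι ℂ (a i)) ^ (k - 1)) (by simp) ?_ ?_ ?_ ?_
    · intro k x y hx hy
      rw [map_add]
      exact ⟨fun h => by rw [hx.1 h, hy.1 h, add_zero], add_mem hx.2 hy.2⟩
    · intro k c x hx
      rw [map_smul]
      exact ⟨fun h => by rw [hx.1 h, smul_zero], Submodule.smul_mem _ _ hx.2⟩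
    · rw [contr_one]
      exact ⟨fun _ => rfl, zero_mem _⟩
    · intro k j x hxm hx
      refine ⟨by simp, ?_⟩
      rw [contr_ι_mul]
      refine sub_mem (Submodule.smul_mem _ _ hxm) ?_
      rcases k with _ | k
      · rw [hx.1 rfl, mul_zero]
        exact zero_mem _
      · rw [Nat.add_sub_cancel, pow_succ']
        exact Submodule.mul_mem_mul (Submodule.subset_span ⟨j, rfl⟩) hx.2
  refine Submodule.mul_induction_on hx (fun y hy z hz => ?_) fun y z hy hz => ?_
  · rw [contr_mul, hbz z hz, mul_zero, add_zero]
    exact Submodule.mul_mem_mul (haz _ y hy).2 hz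
  · rw [map_add]
    exact add_mem hy hz

/-- The Fourier transform takes `p` fibre covectors to `n - p` dual fibre covectors. -/
theorem IsFourier.map_mem_bideg (hF : IsFourier F a b δ a' b' δ') (hb : ∀ i j, δ' i (b' j) = 0)
    {p q : ℕ} (hp : p ≤ n) {x : ExteriorAlgebra ℂ W} (hx : x ∈ bideg a b p q) :
    F x ∈ bideg a' b' (n - p) q := by
  have hone : F 1 ∈ bideg a' b' n 0 := by
    obtain ⟨s, -, h⟩ := hF.map_one
    have hl : ∀ l : List (Fin n), (l.map fun i => ι ℂ (a' i)).prod ∈ bideg a' b' l.length 0 := by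
      intro l
      induction l with
      | nil => exact Submodule.one_le.1 (by simp [bideg])
      | cons i l ih => exact ι_mul_mem_bideg_left a' b' i ih
    have := hl (List.finRange n)
    rw [List.length_finRange] at this
    rw [h]
    exact Submodule.smul_mem _ _ this
  have hq : ∀ z ∈ Submodule.span ℂ (Set.range fun i => ι ℂ (b i)) ^ q, F z ∈ bideg a' b' n q := by
    refine pow_span_induction (fun i => ι ℂ (b i)) (P := fun q z => F z ∈ bideg a' b' n q)
      (by simp) ?_ ?_ hone ?_ q
    · intro k x y hx hy
      rw [map_add]
      exact add_mem hx hy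
    · intro k c x hx
      rw [map_smul]
      exact Submodule.smul_mem _ _ hx
    · intro k j x _ hx
      rw [hF.map_base_mul]
      exact Submodule.smul_mem _ _ (ι_mul_mem_bideg_right a' b' j hx)
  refine Submodule.mul_induction_on hx (fun y hy z hz => ?_) fun y z hy hz => ?_
  · refine pow_span_induction (fun i => ι ℂ (a i))
      (P := fun p y => p ≤ n → F (y * z) ∈ bideg a' b' (n - p) q) (by simp) ?_ ?_ ?_ ?_ p y hy hp
    · intro k x y hx hy hk
      rw [add_mul, map_add]
      exact add_mem (hx hk) (hy hk)
    · intro k c x hx hk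
      rw [smul_mul_assoc, map_smul]
      exact Submodule.smul_mem _ _ (hx hk)
    · intro _
      rw [one_mul]
      exact hq z hz
    · intro k j x _ hx hk
      rw [mul_assoc, hF.map_fiber_mul]
      refine Submodule.smul_mem _ _ (contr_mem_bideg a' b' _ (hb j) ?_)
      rw [show n - (k + 1) + 1 = n - k by omega]
      exact hx (by omega)
  · rw [map_add]
    exact add_mem hy hz

/-- The product of `n` covectors is multiplied by the determinant under a linear change. -/
theorem prod_ι_sum_smul (A : Matrix (Fin n) (Fin n) ℂ) (a : Fin n → W) :
    ((List.finRange n).map fun i => ι ℂ (∑ j, A i j • a j)).prod =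
      A.det • ((List.finRange n).map fun i => ι ℂ (a i)).prod := by
  have hprod : ∀ u : Fin n → W, ((List.finRange n).map fun i => ι ℂ (u i)).prod =
      ExteriorAlgebra.ιMulti ℂ n u := fun u => by
    rw [ExteriorAlgebra.ιMulti_apply, List.ofFn_eq_map]
  rw [hprod, hprod]
  -- both sides are alternating in the rows of `A`, so they may be compared on the standard basis
  have h : (ExteriorAlgebra.ιMulti ℂ n).compLinearMap
        (∑ j, (LinearMap.proj j : (Fin n → ℂ) →ₗ[ℂ] ℂ).smulRight (a j)) =
      (LinearMap.toSpanSingleton ℂ _ (ExteriorAlgebra.ιMulti ℂ n a)).compAlternatingMap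
        Matrix.detRowAlternating := by
    refine Module.Basis.ext_alternating (Pi.basisFun ℂ (Fin n)) fun σ hσ => ?_
    obtain ⟨σ, rfl⟩ : ∃ τ : Equiv.Perm (Fin n), (τ : Fin n → Fin n) = σ :=
      ⟨Equiv.ofBijective σ (Finite.injective_iff_bijective.1 hσ), rfl⟩
    have h1 := AlternatingMap.map_perm ((ExteriorAlgebra.ιMulti ℂ n).compLinearMap
        (∑ j, (LinearMap.proj j : (Fin n → ℂ) →ₗ[ℂ] ℂ).smulRight (a j)))
        (fun i => Pi.basisFun ℂ (Fin n) i) σ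
    have h2 := AlternatingMap.map_perm ((LinearMap.toSpanSingleton ℂ _
      (ExteriorAlgebra.ιMulti ℂ n a)).compAlternatingMap Matrix.detRowAlternating)
        (fun i => Pi.basisFun ℂ (Fin n) i) σ
    refine h1.trans (Eq.trans ?_ h2.symm)
    congr 1
    have hdet : Matrix.detRowAlternating (fun i => Pi.basisFun ℂ (Fin n) i) = 1 := by
      rw [← Pi.basisFun_det]
      exact Module.Basis.det_self _
    rw [LinearMap.compAlternatingMap_apply, hdet, LinearMap.toSpanSingleton_apply_one,
      AlternatingMap.compLinearMap_apply]
    congr 1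
    funext i
    simp [Pi.single_apply]
  have h3 := AlternatingMap.congr_fun h A
  refine Eq.trans (congrArg _ (funext fun i => ?_)) h3
  simp

end Fourier

/-! ### The Fourier-Mukai transform at a point -/

section FourierMukai

variable {n : ℕ}

open ExteriorAlgebra (ι)

/-- The functional `α ↦ α(∂/∂z_i)` on complex covectors. -/
def delz (i : Fin n) : Module.Dual ℂ (Cpx n →ₗ[ℝ] ℂ) :=
  (1 / 2 : ℂ) • (evalAt (ethC i) - Complex.I • evalAt (erC i))

theorem evalAt_apply {V : Type*} [AddCommGroup V] [Module ℝ V] (v : V) (α : V →ₗ[ℝ] ℂ) :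
    evalAt v α = α v := rfl

theorem dz_ethC (i j : Fin n) : dz j (ethC i) = if j = i then 1 else 0 := by
  simp [dz, ethC, Pi.single_apply]

theorem dz_erC (i j : Fin n) : dz j (erC i) = if j = i then Complex.I else 0 := by
  simp [dz, erC, Pi.single_apply]

theorem dzbar_ethC (i j : Fin n) : dzbar j (ethC i) = if j = i then 1 else 0 := by
  simp [dzbar, ethC, Pi.single_apply, apply_ite]

theorem dzbar_erC (i j : Fin n) : dzbar j (erC i) = if j = i then -Complex.I else 0 := by
  simp [dzbar, erC, Pi.single_apply, apply_ite]

theorem dthC_ethC (i j : Fin n) : dthC j (ethC i) = if j = i then 1 else 0 := by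
  simp [dthC, ethC, Pi.single_apply, apply_ite]

theorem dthC_erC (i j : Fin n) : dthC j (erC i) = 0 := by
  simp [dthC, erC, Pi.single_apply, apply_ite]

theorem drC_ethC (i j : Fin n) : drC j (ethC i) = 0 := by
  simp [drC, ethC, Pi.single_apply, apply_ite]

theorem drC_erC (i j : Fin n) : drC j (erC i) = if j = i then 1 else 0 := by
  simp [drC, erC, Pi.single_apply, apply_ite]

theorem dr_er (i j : Fin n) : dr j (er i) = if j = i then 1 else 0 := by
  simp [dr, er, Pi.single_apply, apply_ite]

theorem dr_eth (i j : Fin n) : dr j (eth i) = 0 := by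
  simp [dr, eth]

theorem dth_eth (i j : Fin n) : dth j (eth i) = if j = i then 1 else 0 := by
  simp [dth, eth, Pi.single_apply, apply_ite]

theorem delz_dz (i j : Fin n) : delz i (dz j) = if j = i then 1 else 0 := by
  simp only [delz, LinearMap.smul_apply, LinearMap.sub_apply, evalAt_apply, dz_ethC, dz_erC]
  split_ifs <;> simp
  norm_num

theorem delz_dzbar (i j : Fin n) : delz i (dzbar j) = 0 := by
  simp only [delz, LinearMap.smul_apply, LinearMap.sub_apply, evalAt_apply, dzbar_ethC, dzbar_erC]
  split_ifs <;> simp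

theorem switch1_apply (α : Cpx n →ₗ[ℝ] ℂ) :
    switch1 α = ∑ i, (delz i α • dthC i +
      ((1 / 2 : ℂ) * (α (ethC i) + Complex.I * α (erC i))) • drC i) := by
  simp only [switch1, delz, LinearMap.sum_apply, LinearMap.add_apply, LinearMap.smulRight_apply,
    LinearMap.smul_apply, evalAt_apply, smul_eq_mul]

theorem switch1_dz (i : Fin n) : switch1 (dz i) = dthC i := by
  rw [switch1_apply, Finset.sum_eq_single i]
  · simp [delz_dz, dz_ethC, dz_erC]
  · intro j _ hj
    simp [delz_dz, dz_ethC, dz_erC, hj.symm]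
  · simp

theorem switch1_dzbar (i : Fin n) : switch1 (dzbar i) = drC i := by
  rw [switch1_apply, Finset.sum_eq_single i]
  · simp [delz_dzbar, dzbar_ethC, dzbar_erC]
    norm_num
  · intro j _ hj
    simp [delz_dzbar, dzbar_ethC, dzbar_erC, hj.symm]
  · simp

theorem unswitch1_apply (α : Cpx n →ₗ[ℝ] ℂ) :
    unswitch1 α = ∑ i, (α (ethC i) • dz i + α (erC i) • dzbar i) := by
  simp only [unswitch1, LinearMap.sum_apply, LinearMap.add_apply, LinearMap.smulRight_apply,
    evalAt_apply]

theorem unswitch1_dthC (i : Fin n) : unswitch1 (dthC i) = dz i := by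
  rw [unswitch1_apply, Finset.sum_eq_single i]
  · simp [dthC_ethC, dthC_erC]
  · intro j _ hj
    simp [dthC_ethC, dthC_erC, hj.symm]
  · simp

theorem unswitch1_drC (i : Fin n) : unswitch1 (drC i) = dzbar i := by
  rw [unswitch1_apply, Finset.sum_eq_single i]
  · simp [drC_ethC, drC_erC]
  · intro j _ hj
    simp [drC_ethC, drC_erC, hj.symm]
  · simp

/-- `dθ̌_i = (dz_i + d z̄_i) / 2`. -/
theorem dthC_eq (i : Fin n) : dthC i = (1 / 2 : ℂ) • (dz i + dzbar i) := by
  refine LinearMap.ext fun z => ?_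
  apply Complex.ext <;> simp [dthC, dz, dzbar]
  ring

/-- `dr_i = i (d z̄_i - dz_i) / 2`. -/
theorem drC_eq (i : Fin n) : drC i = (1 / 2 : ℂ) • (Complex.I • (dzbar i - dz i)) := by
  refine LinearMap.ext fun z => ?_
  apply Complex.ext <;> simp [drC, dz, dzbar]
  ring

theorem cpx_eq_sum (z : Cpx n) : z = ∑ i, ((z i).re • ethC i + (z i).im • erC i) := by
  funext j
  simp only [Finset.sum_apply, Pi.add_apply, Pi.smul_apply]
  rw [Finset.sum_eq_single j]
  · apply Complex.ext <;> simp [ethC, erC]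
  · intro i _ hi
    simp [ethC, erC, hi.symm]
  · simp

theorem dar_eq_sum (y : Dar n) : y = ∑ i, (y.2 i • eth i + y.1 i • er i) := by
  refine Prod.ext ?_ ?_ <;> funext j
  · rw [Prod.fst_sum, Finset.sum_apply, Finset.sum_eq_single j] <;>
      simp +contextual [eth, er, eq_comm]
  · rw [Prod.snd_sum, Finset.sum_apply, Finset.sum_eq_single j] <;>
      simp +contextual [eth, er, eq_comm]

theorem span_dthC_drC : Submodule.span ℂ (Set.range (dthC (n := n)) ∪ Set.range drC) = ⊤ := by
  refine eq_top_iff.2 fun α _ => ?_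
  have h : α = ∑ i, (α (ethC i) • dthC i + α (erC i) • drC i) := by
    refine LinearMap.ext fun z => ?_
    conv_lhs => rw [cpx_eq_sum z]
    simp [dthC, drC, mul_comm]
  rw [h]
  exact sum_mem fun i _ => add_mem
    (Submodule.smul_mem _ _ (Submodule.subset_span (Or.inl ⟨i, rfl⟩)))
    (Submodule.smul_mem _ _ (Submodule.subset_span (Or.inr ⟨i, rfl⟩)))

theorem span_dz_dzbar : Submodule.span ℂ (Set.range (dz (n := n)) ∪ Set.range dzbar) = ⊤ := by
  refine eq_top_iff.2 (span_dthC_drC.symm.le.trans (Submodule.span_le.2 ?_))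
  have h1 (i : Fin n) : dz i ∈ Submodule.span ℂ (Set.range (dz (n := n)) ∪ Set.range dzbar) :=
    Submodule.subset_span (Or.inl ⟨i, rfl⟩)
  have h2 (i : Fin n) : dzbar i ∈ Submodule.span ℂ (Set.range (dz (n := n)) ∪ Set.range dzbar) :=
    Submodule.subset_span (Or.inr ⟨i, rfl⟩)
  rintro _ (⟨i, rfl⟩ | ⟨i, rfl⟩)
  · rw [dthC_eq]
    exact Submodule.smul_mem _ _ (add_mem (h1 i) (h2 i))
  · rw [drC_eq]
    exact Submodule.smul_mem _ _ (Submodule.smul_mem _ _ (sub_mem (h2 i) (h1 i)))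

theorem span_dth_dr : Submodule.span ℂ (Set.range (dth (n := n)) ∪ Set.range dr) = ⊤ := by
  refine eq_top_iff.2 fun α _ => ?_
  have h : α = ∑ i, (α (eth i) • dth i + α (er i) • dr i) := by
    refine LinearMap.ext fun y => ?_
    conv_lhs => rw [dar_eq_sum y]
    simp [dth, dr, mul_comm]
  rw [h]
  exact sum_mem fun i _ => add_mem
    (Submodule.smul_mem _ _ (Submodule.subset_span (Or.inl ⟨i, rfl⟩)))
    (Submodule.smul_mem _ _ (Submodule.subset_span (Or.inr ⟨i, rfl⟩)))

/-- Pullback of covectors. -/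
abbrev pull1 {V W : Type*} [AddCommGroup V] [Module ℝ V] [AddCommGroup W] [Module ℝ W]
    (f : V →ₗ[ℝ] W) : (W →ₗ[ℝ] ℂ) →ₗ[ℂ] (V →ₗ[ℝ] ℂ) := LinearMap.lcomp ℂ ℂ f

theorem pull1_apply {V W : Type*} [AddCommGroup V] [Module ℝ V] [AddCommGroup W] [Module ℝ W]
    (f : V →ₗ[ℝ] W) (α : W →ₗ[ℝ] ℂ) (v : V) : pull1 f α v = α (f v) := rfl

/-- The covector `dθ̌_i` on the fibre product. -/
def fibThC (i : Fin n) : Fib n →ₗ[ℝ] ℂ :=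
  Complex.ofRealCLM.toLinearMap ∘ₗ LinearMap.proj i ∘ₗ LinearMap.snd ℝ (Dar n) _

/-- The covector `dθ_i` on the fibre product. -/
def fibTh (i : Fin n) : Fib n →ₗ[ℝ] ℂ := dth i ∘ₗ toDar

theorem expForm_eq_truncExp (K : Ext (Fib n)) : expForm K = truncExp n K := rfl

theorem curv_eq : curv = ∑ i : Fin n, ι ℂ (fibThC i) * ι ℂ (fibTh i) := rfl

theorem neg_curv_eq : -curv = ∑ i : Fin n, ι ℂ (-fibThC i) * ι ℂ (fibTh i) := by
  simp [curv_eq]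

/-- The Fourier-Mukai transform at a point, from the mirror to the symplectic side. -/
def ftLin : Ext (Cpx n) →ₗ[ℂ] Ext (Dar n) :=
  fiberTransform (pull1 toCpx ∘ₗ switch1) (pull1 ofDar)
    (fun i : Fin n => evalAt ((0, Pi.single i 1) : Fib n)) (expForm curv)

/-- The Fourier-Mukai transform at a point, from the symplectic side to the mirror. -/
def ftInvLin : Ext (Dar n) →ₗ[ℂ] Ext (Cpx n) :=
  fiberTransform (pull1 toDar) (unswitch1 ∘ₗ pull1 ofCpx)
    (fun i : Fin n => evalAt ((eth i, 0) : Fib n)) (expForm (-curv))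

theorem contractAll_eq {V : Type*} [AddCommGroup V] [Module ℝ V] (v : Fin n → V) (ψ : Ext V) :
    contractAll v ψ = contrList ((List.finRange n).map fun i => evalAt (v i)) ψ := by
  rw [contractAll]
  generalize List.finRange n = l
  induction l generalizing ψ with
  | nil => rfl
  | cons i l ih => exact ih _

theorem ftLin_apply (η : Ext (Cpx n)) : ftLin η = pull ofDar
    (contractAll (fun i => ((0, Pi.single i 1) : Fib n))
      (pull toCpx (polSwitch η) * expForm curv)) := by
  rw [ftLin, fiberTransform_apply, contractAll_eq, ← ExteriorAlgebra.map_comp_map]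
  rfl

theorem ftInvLin_apply (η : Ext (Dar n)) : ftInvLin η = polUnswitch (pull ofCpx
    (contractAll (fun i => ((eth i, 0) : Fib n))
      (pull toDar η * expForm (-curv)))) := by
  rw [ftInvLin, fiberTransform_apply, contractAll_eq, ← ExteriorAlgebra.map_comp_map]
  rfl

theorem fibThC_right (i j : Fin n) :
    fibThC j ((0, Pi.single i 1) : Fib n) = if j = i then 1 else 0 := by
  simp [fibThC, Pi.single_apply, apply_ite]

theorem fibTh_right (i j : Fin n) : fibTh j ((0, Pi.single i 1) : Fib n) = 0 := by
  simp [fibTh, toDar]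

theorem fibThC_left (i j : Fin n) : fibThC j ((eth i, 0) : Fib n) = 0 := by
  simp [fibThC]

theorem fibTh_left (i j : Fin n) : fibTh j ((eth i, 0) : Fib n) = if j = i then 1 else 0 :=
  dth_eth i j

theorem pull1_toCpx_dthC (i : Fin n) : pull1 toCpx (dthC i) = fibThC i := by
  refine LinearMap.ext fun w => ?_
  simp [toCpx, dthC, fibThC, mkCpx]

theorem toCpx_right (i : Fin n) : toCpx ((0, Pi.single i 1) : Fib n) = ethC i := by
  funext j
  simp [toCpx, ethC, mkCpx, Pi.single_apply, apply_ite]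

theorem toCpx_left (i : Fin n) : toCpx ((eth i, 0) : Fib n) = 0 := by
  funext j
  simp [toCpx, mkCpx, eth]

theorem evalAt_ethC_comp_switch1 (i : Fin n) : evalAt (ethC i) ∘ₗ switch1 = delz i := by
  refine LinearMap.ext fun α => ?_
  simp only [LinearMap.comp_apply, switch1_apply, map_sum, map_add, map_smul, evalAt_apply,
    dthC_ethC, drC_ethC]
  simp

theorem delz_comp_unswitch1 (i : Fin n) : delz i ∘ₗ unswitch1 = evalAt (ethC i) := by
  refine LinearMap.ext fun α => ?_
  simp only [LinearMap.comp_apply, unswitch1_apply, map_sum, map_add, map_smul, evalAt_apply,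
    delz_dz, delz_dzbar]
  simp

theorem isFourier_ftLin :
    IsFourier (ftLin (n := n)) dz dzbar delz dth dr (fun i => evalAt (eth i)) := by
  rw [ftLin, expForm_eq_truncExp, curv_eq]
  refine isFourier_fiberTransform (κ := fibTh) (w := fun i => evalAt ((eth i, 0) : Fib n))
    ?_ ?_ ?_ ?_ ?_ ?_ ?_ ?_ ?_ ?_
  · intro i
    simp only [evalAt_apply, fibThC_right, fibTh_right]
    simp
  · intro i j
    exact fibTh_right i j
  · intro i
    rfl
  · intro i
    rw [← evalAt_ethC_comp_switch1, ← toCpx_right]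
    rfl
  · intro i
    simp only [evalAt_apply, fibThC_left, fibTh_left, LinearMap.comp_apply, switch1_dz,
      pull1_toCpx_dthC]
    simp
  · intro i
    refine LinearMap.ext fun α => ?_
    simp only [LinearMap.comp_apply, evalAt_apply, pull1_apply, toCpx_left, map_zero,
      LinearMap.zero_apply]
  · intro i
    rfl
  · intro i j
    simp only [LinearMap.comp_apply, switch1_dzbar, evalAt_apply, pull1_apply, toCpx_right,
      drC_ethC]
  · intro i
    rw [LinearMap.comp_apply, switch1_dzbar]
    refine LinearMap.ext fun y => ?_
    simp [ofDar, toCpx, drC, dr]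
  · intro i
    have : pull1 ofDar (fibThC i) = 0 := by
      refine LinearMap.ext fun y => ?_
      simp [ofDar, fibThC]
    rw [this, map_zero, zero_mul]

theorem isFourier_ftInvLin :
    IsFourier (ftInvLin (n := n)) dth dr (fun i => evalAt (eth i)) dz dzbar delz := by
  rw [ftInvLin, expForm_eq_truncExp, neg_curv_eq]
  refine isFourier_fiberTransform (κ := fibThC)
    (w := fun i => evalAt ((0, Pi.single i 1) : Fib n)) ?_ ?_ ?_ ?_ ?_ ?_ ?_ ?_ ?_ ?_
  · intro i
    simp only [evalAt_apply, LinearMap.neg_apply, fibThC_left, fibTh_left]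
    simp
  · intro i j
    exact fibThC_left i j
  · intro i
    have : pull1 ofCpx (fibThC i) = dthC i := by
      refine LinearMap.ext fun z => ?_
      simp [ofCpx, fibThC, dthC]
    rw [LinearMap.comp_apply, this, unswitch1_dthC]
  · intro i
    rfl
  · intro i
    simp only [evalAt_apply, LinearMap.neg_apply, fibThC_right, fibTh_right]
    simp
    rfl
  · intro i
    refine LinearMap.ext fun α => ?_
    simp [evalAt_apply, toDar]
  · intro i
    rw [← LinearMap.comp_assoc, delz_comp_unswitch1]
    refine LinearMap.ext fun α => ?_
    simp only [LinearMap.comp_apply, evalAt_apply, pull1_apply]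
    congr 1
    refine Prod.ext (Prod.ext ?_ rfl) ?_ <;> funext j <;>
      simp [ofCpx, imPart, ethC, Pi.single_apply, apply_ite]
  · intro i j
    exact dr_eth i j
  · intro i
    have : pull1 ofCpx (pull1 toDar (dr i)) = drC i := by
      refine LinearMap.ext fun z => ?_
      simp [ofCpx, toDar, drC, dr]
    rw [LinearMap.comp_apply, this, unswitch1_drC]
  · intro i
    have : pull1 ofCpx (fibTh i) = 0 := by
      refine LinearMap.ext fun z => ?_
      simp [ofCpx, fibTh, toDar, dth]
    rw [LinearMap.comp_apply (f := unswitch1) (x := fibTh i), this, map_zero, map_zero, mul_zero]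

theorem exists_ftInvLin_ftLin :
    ∃ c : ℂ, c ≠ 0 ∧ ∀ x : Ext (Cpx n), ftInvLin (ftLin x) = c • x :=
  isFourier_ftLin.inversion isFourier_ftInvLin (fun i => by simp [delz_dz])
    (fun i j h => by simp [delz_dz, h.symm]) span_dz_dzbar

theorem exists_ftLin_ftInvLin :
    ∃ c : ℂ, c ≠ 0 ∧ ∀ x : Ext (Dar n), ftLin (ftInvLin x) = c • x :=
  isFourier_ftInvLin.inversion isFourier_ftLin (fun i => by simp [evalAt_apply, dth_eth])
    (fun i j h => by simp [evalAt_apply, dth_eth, h.symm]) span_dth_dr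

theorem ftLin_injective : Function.Injective (ftLin (n := n)) := by
  obtain ⟨c, hc, h⟩ := exists_ftInvLin_ftLin (n := n)
  intro x y hxy
  refine smul_right_injective _ hc ?_
  simp only [← h, hxy]

theorem ftLin_mem_bidegree {p q : ℕ} (hp : p ≤ n) {x : Ext (Cpx n)}
    (hx : x ∈ bidegree dz dzbar p q) : ftLin x ∈ bidegree dth dr (n - p) q :=
  isFourier_ftLin.map_mem_bideg (fun i j => dr_eth i j) hp hx

theorem ftInvLin_mem_bidegree {p q : ℕ} (hp : p ≤ n) {x : Ext (Dar n)}
    (hx : x ∈ bidegree dth dr (n - p) q) : ftInvLin x ∈ bidegree dz dzbar p q := by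
  have h := isFourier_ftInvLin.map_mem_bideg (fun i j => delz_dzbar i j) (Nat.sub_le n p) hx
  rwa [Nat.sub_sub_self hp] at h

theorem ftLin_dz_mul (i : Fin n) (x : Ext (Cpx n)) :
    ftLin (wedgeL (dz i) x) = -(-1 : ℂ) ^ n • inter (eth i) (ftLin x) :=
  isFourier_ftLin.map_fiber_mul i x

theorem ftLin_dzbar_mul (i : Fin n) (x : Ext (Cpx n)) :
    ftLin (wedgeL (dzbar i) x) = (-1 : ℂ) ^ n • wedgeL (dr i) (ftLin x) :=
  isFourier_ftLin.map_base_mul i x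

/-- Integration of a constant over the unit cube. -/
theorem setIntegral_const {W : Type*} [AddCommGroup W] [Module ℂ W] [Module.Finite ℂ W] (w : W) :
    setIntegral (Set.Icc (0 : Fin n → ℝ) 1) (fun _ => w) = w := by
  have hv : MeasureTheory.volume.real (Set.Icc (0 : Fin n → ℝ) 1) = 1 := by
    simp [MeasureTheory.measureReal_def, Real.volume_Icc_pi]
  simp only [setIntegral, MeasureTheory.setIntegral_const, hv, one_smul]
  exact (Module.finBasis ℂ W).sum_repr w

/-- For a form whose coefficients are constant on the fibre, the transform is a linear map at each
point. -/
theorem ftLoc_eq {f : Cpx n → Ext (Cpx n)} {y : Dar n}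
    (h : ∀ t t', f (mkCpx y.1 t) = f (mkCpx y.1 t')) : ftLoc f y = ftLin (f (mkCpx y.1 0)) := by
  rw [ftLoc, ftLin_apply]
  simp only [fun t => h t 0]
  exact setIntegral_const _

theorem ftInvLoc_eq {f : Dar n → Ext (Dar n)} {z : Cpx n}
    (h : ∀ t t', f (imPart z, t) = f (imPart z, t')) :
    ftInvLoc f z = ftInvLin (f (imPart z, 0)) := by
  rw [ftInvLoc, ftInvLin_apply]
  simp only [fun t => h t 0]
  exact congrArg _ (setIntegral_const _)

end FourierMukai

/-! ### Naturality under changes of semi-flat coordinates -/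

section Naturality

variable {n : ℕ}

open ExteriorAlgebra (ι)

/-- The linear part `(r, θ) ↦ (A r, A^{-T} θ)` of a change of action-angle coordinates. -/
def darMap (A : Matrix.SpecialLinearGroup (Fin n) ℤ) : Dar n →ₗ[ℝ] Dar n :=
  LinearMap.prodMap (Matrix.mulVecLin ((A : Matrix (Fin n) (Fin n) ℤ).map (Int.cast : ℤ → ℝ)))
    (Matrix.mulVecLin
      ((A⁻¹.transpose : Matrix (Fin n) (Fin n) ℤ).map (Int.cast : ℤ → ℝ)))

/-- The linear part `z ↦ A z` of a change of complex coordinates on the mirror. -/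
def cpxMap (A : Matrix.SpecialLinearGroup (Fin n) ℤ) : Cpx n →ₗ[ℂ] Cpx n :=
  Matrix.mulVecLin ((A : Matrix (Fin n) (Fin n) ℤ).map (Int.cast : ℤ → ℂ))

theorem darMap_apply (A : Matrix.SpecialLinearGroup (Fin n) ℤ) (y : Dar n) :
    darMap A y = (act A y.1, coact A y.2) := rfl

theorem cpxMap_apply (A : Matrix.SpecialLinearGroup (Fin n) ℤ) (z : Cpx n) (i : Fin n) :
    cpxMap A z i = ∑ j, (A i j : ℂ) * z j := by
  simp [cpxMap, Matrix.mulVec, dotProduct]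

theorem act_apply (A : Matrix.SpecialLinearGroup (Fin n) ℤ) (v : Fin n → ℝ) (i : Fin n) :
    act A v i = ∑ j, (A i j : ℝ) * v j := by
  simp [act, Matrix.mulVec, dotProduct]

theorem coact_apply (A : Matrix.SpecialLinearGroup (Fin n) ℤ) (v : Fin n → ℝ) (i : Fin n) :
    coact A v i = ∑ j, (A⁻¹ j i : ℝ) * v j := by
  rw [coact, act_apply]
  rfl

theorem cpxMap_mkCpx (A : Matrix.SpecialLinearGroup (Fin n) ℤ) (r t : Fin n → ℝ) :
    cpxMap A (mkCpx r t) = mkCpx (act A r) (act A t) := by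
  funext i
  simp only [mkCpx, cpxMap_apply, act_apply]
  push_cast
  rw [Finset.mul_sum, ← Finset.sum_add_distrib]
  exact Finset.sum_congr rfl fun j _ => by ring

theorem dz_comp_cpxMap (A : Matrix.SpecialLinearGroup (Fin n) ℤ) (i : Fin n) :
    pull1 ((cpxMap A).restrictScalars ℝ) (dz i) = ∑ j, (A i j : ℂ) • dz j := by
  refine LinearMap.ext fun z => ?_
  simp [dz, cpxMap_apply]

theorem dzbar_comp_cpxMap (A : Matrix.SpecialLinearGroup (Fin n) ℤ) (i : Fin n) :
    pull1 ((cpxMap A).restrictScalars ℝ) (dzbar i) = ∑ j, (A i j : ℂ) • dzbar j := by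
  refine LinearMap.ext fun z => ?_
  simp [dzbar, cpxMap_apply]

theorem dr_comp_darMap (A : Matrix.SpecialLinearGroup (Fin n) ℤ) (i : Fin n) :
    pull1 (darMap A) (dr i) = ∑ j, (A i j : ℂ) • dr j := by
  refine LinearMap.ext fun z => ?_
  simp [dr, darMap_apply, act_apply]

theorem dth_comp_darMap (A : Matrix.SpecialLinearGroup (Fin n) ℤ) (i : Fin n) :
    pull1 (darMap A) (dth i) = ∑ j, (A⁻¹ j i : ℂ) • dth j := by
  refine LinearMap.ext fun z => ?_
  simp [dth, darMap_apply, coact_apply]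

/-- The vector `A^T e_i` along the fibre is mapped to `∂/∂θ_i`. -/
theorem darMap_sum_eth (A : Matrix.SpecialLinearGroup (Fin n) ℤ) (i : Fin n) :
    darMap A (∑ j, (A i j : ℝ) • eth j) = eth i := by
  refine Prod.ext ?_ ?_ <;> funext k
  · simp [darMap_apply, act_apply, eth, Prod.fst_sum]
  · have h : ∑ j, A i j * A⁻¹ j k = if i = k then 1 else 0 := by
      have := congrArg (fun M : Matrix.SpecialLinearGroup (Fin n) ℤ => M i k) (mul_inv_cancel A)
      rw [Matrix.SpecialLinearGroup.coe_mul, Matrix.mul_apply, Matrix.SpecialLinearGroup.coe_one,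
        Matrix.one_apply] at this
      exact this
    have h' : ∑ j, (A i j : ℝ) * (A⁻¹ j k : ℝ) = if i = k then 1 else 0 := by
      exact_mod_cast h
    simp only [darMap_apply, coact_apply, eth, Prod.snd_sum, Prod.smul_snd, Finset.sum_apply,
      Pi.smul_apply, Pi.single_apply, smul_eq_mul, mul_ite, mul_one, mul_zero, Finset.sum_ite_eq,
      Finset.mem_univ, if_true]
    rw [if_congr (eq_comm (a := k)) rfl rfl, ← h']
    exact Finset.sum_congr rfl fun j _ => mul_comm _ _

theorem inter_pull {V W : Type*} [AddCommGroup V] [Module ℝ V] [AddCommGroup W] [Module ℝ W]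
    (f : V →ₗ[ℝ] W) (v : V) (x : Ext W) : inter v (pull f x) = pull f (inter (f v) x) :=
  contr_map (pull1 f) (evalAt v) x

theorem inter_sum_smul {V : Type*} [AddCommGroup V] [Module ℝ V] {J : Type*} (s : Finset J)
    (c : J → ℝ) (v : J → V) (x : Ext V) :
    inter (∑ j ∈ s, c j • v j) x = ∑ j ∈ s, (c j : ℂ) • inter (v j) x := by
  have h : evalAt (∑ j ∈ s, c j • v j) = ∑ j ∈ s, (c j : ℂ) • evalAt (v j) := by
    refine LinearMap.ext fun α => ?_
    simp [evalAt_apply, LinearMap.sum_apply]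
  simp only [inter, h, map_sum, map_smul, LinearMap.sum_apply, LinearMap.smul_apply]

theorem pull_wedgeL {V W : Type*} [AddCommGroup V] [Module ℝ V] [AddCommGroup W] [Module ℝ W]
    (f : V →ₗ[ℝ] W) (α : W →ₗ[ℝ] ℂ) (x : Ext W) :
    pull f (wedgeL α x) = wedgeL (pull1 f α) (pull f x) := by
  simp only [wedgeL, LinearMap.mulLeft_apply, map_mul]
  congr 1
  exact ExteriorAlgebra.map_apply_ι _ _

theorem wedgeL_sum_smul {V : Type*} [AddCommGroup V] [Module ℝ V] {J : Type*} (s : Finset J)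
    (c : J → ℂ) (α : J → V →ₗ[ℝ] ℂ) (x : Ext V) :
    wedgeL (∑ j ∈ s, c j • α j) x = ∑ j ∈ s, c j • wedgeL (α j) x := by
  simp only [wedgeL, LinearMap.mulLeft_apply, map_sum, map_smul, Finset.sum_mul, smul_mul_assoc]

/-- The Fourier-Mukai transform is compatible with changes of semi-flat coordinates.  The volume
form of the torus fibre is preserved because the determinant is one. -/
theorem ftLin_pull (A : Matrix.SpecialLinearGroup (Fin n) ℤ) (x : Ext (Cpx n)) :
    ftLin (pull ((cpxMap A).restrictScalars ℝ) x) = pull (darMap A) (ftLin x) := by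
  refine linearMap_ext_of_ι_mul
    (F := ftLin ∘ₗ (pull ((cpxMap A).restrictScalars ℝ)).toLinearMap)
    (G := (pull (darMap A)).toLinearMap ∘ₗ ftLin) ?_ _ span_dz_dzbar ?_ x
  · obtain ⟨s, -, hs⟩ := (isFourier_ftLin (n := n)).map_one
    simp only [LinearMap.comp_apply, AlgHom.toLinearMap_apply, map_one, hs, map_smul]
    congr 1
    have hdet : (Matrix.of fun i j => (A⁻¹ j i : ℂ)).det = 1 := by
      have h := congrArg (Int.cast : ℤ → ℂ) (A⁻¹.transpose).2
      rw [Int.cast_det, Int.cast_one] at h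
      exact h
    have h := prod_ι_sum_smul (Matrix.of fun i j => (A⁻¹ j i : ℂ)) (dth (n := n))
    rw [hdet, one_smul] at h
    rw [map_list_prod, List.map_map, ← h]
    congr 2
    funext i
    rw [Function.comp_apply, pull, ExteriorAlgebra.map_apply_ι]
    exact congrArg _ (dth_comp_darMap A i).symm
  · rintro α (⟨i, rfl⟩ | ⟨i, rfl⟩) x hx <;>
      simp only [LinearMap.comp_apply, AlgHom.toLinearMap_apply] at hx ⊢
    · change ftLin (pull _ (wedgeL (dz i) x)) = pull _ (ftLin (wedgeL (dz i) x))
      rw [pull_wedgeL, dz_comp_cpxMap, wedgeL_sum_smul, map_sum, ftLin_dz_mul, map_smul,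
        ← darMap_sum_eth A i, ← inter_pull, inter_sum_smul, Finset.smul_sum, ← hx]
      refine Finset.sum_congr rfl fun j _ => ?_
      rw [map_smul, ftLin_dz_mul, smul_comm, Complex.ofReal_intCast]
    · change ftLin (pull _ (wedgeL (dzbar i) x)) = pull _ (ftLin (wedgeL (dzbar i) x))
      rw [pull_wedgeL, dzbar_comp_cpxMap, wedgeL_sum_smul, map_sum, ftLin_dzbar_mul, map_smul,
        pull_wedgeL, dr_comp_darMap, wedgeL_sum_smul, Finset.smul_sum, ← hx]
      refine Finset.sum_congr rfl fun j _ => ?_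
      rw [map_smul, ftLin_dzbar_mul, smul_comm]

theorem ftInvLin_pull (A : Matrix.SpecialLinearGroup (Fin n) ℤ) (x : Ext (Dar n)) :
    ftInvLin (pull (darMap A) x) = pull ((cpxMap A).restrictScalars ℝ) (ftInvLin x) := by
  obtain ⟨c, hc, h⟩ := exists_ftLin_ftInvLin (n := n)
  refine ftLin_injective ?_
  rw [h, ftLin_pull, h, map_smul]

end Naturality

/-! ### Differential operators on torus-invariant forms -/

section InvariantCalculus

section General

variable {H H' W W' : Type*} [NormedAddCommGroup H] [NormedSpace ℝ H] [NormedAddCommGroup H']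
  [NormedSpace ℝ H'] [AddCommGroup W] [Module ℂ W] [AddCommGroup W'] [Module ℂ W']

theorem SmoothOn.comp_clm {g : H' → W} {U : Set H'} (hg : SmoothOn g U) (L : H →L[ℝ] H')
    {V : Set H} (hV : ∀ y ∈ V, L y ∈ U) : SmoothOn (fun y => g (L y)) V := fun l =>
  (hg l).comp L.contDiff.contDiffOn hV

variable [Module.Finite ℂ W] [Module.Finite ℂ W']

theorem partialD_sum_linear {J : Type*} [Fintype J] {k : J → H → W} {U : Set H} (hU : IsOpen U)
    (hk : ∀ j, SmoothOn (k j) U) (T : J → W →ₗ[ℂ] W') {y : H} (hy : y ∈ U) (v : H) :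
    partialD v (fun u => ∑ j, T j (k j u)) y = ∑ j, T j (partialD v (k j) y) :=
  partialD_ext fun l => by
    rw [dual_partialD hU (SmoothOn.sum _ fun j => (hk j).linear (T j)) hy, map_sum]
    simp only [map_sum]
    rw [fderiv_fun_sum fun j _ => ((hk j).linear (T j)).differentiableAt hU hy l, sum_apply]
    exact Finset.sum_congr rfl fun j _ => (dual_partialD hU (hk j) hy v (l ∘ₗ T j)).symm

theorem partialD_comp {g : H' → W} {U : Set H'} (hU : IsOpen U) (hg : SmoothOn g U)
    (T : W →ₗ[ℂ] W') (L : H →L[ℝ] H') {y : H} (hy : L y ∈ U) (v : H) :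
    partialD v (fun u => T (g (L u))) y = T (partialD (L v) g (L y)) :=
  partialD_ext fun l => by
    rw [dual_partialD (hU.preimage L.continuous)
      ((hg.comp_clm L (V := L ⁻¹' U) fun _ h => h).linear T) hy]
    have h1 := dual_partialD hU hg hy (L v) (l ∘ₗ T)
    rw [LinearMap.comp_apply] at h1
    rw [h1]
    have h2 : DifferentiableAt ℝ (fun u => l (T (g u))) (L y) :=
      hg.differentiableAt hU hy (l ∘ₗ T)
    have h3 := fderiv_comp y h2 L.differentiableAt
    rw [ContinuousLinearMap.fderiv] at h3
    exact congrArg (fun f => f v) h3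

/-- Second partial derivatives commute. -/
theorem partialD_comm {g : H → W} {U : Set H} (hU : IsOpen U) (hg : SmoothOn g U) {y : H}
    (hy : y ∈ U) (v w : H) : partialD v (partialD w g) y = partialD w (partialD v g) y :=
  partialD_ext fun l => by
    have key : ∀ v w : H, l (partialD v (partialD w g) y) =
        fderiv ℝ (fderiv ℝ fun u => l (g u)) y v w := by
      intro v w
      rw [dual_partialD hU (hg.partialD hU w) hy]
      have h : (fun u => l (partialD w g u)) =ᶠ[nhds y]
          fun u => fderiv ℝ (fun u => l (g u)) u w := by
        filter_upwards [hU.mem_nhds hy] with u hu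
        exact dual_partialD hU hg hu w l
      rw [h.fderiv_eq]
      have hd : DifferentiableAt ℝ (fderiv ℝ fun u => l (g u)) y :=
        (((hg l).fderiv_of_isOpen hU (m := ∞) (by simp)).contDiffAt
          (hU.mem_nhds hy)).differentiableAt (by simp)
      have h2 := fderiv_clm_apply hd (differentiableAt_const w)
      rw [h2]
      simp
    rw [key, key]
    have hs : IsSymmSndFDerivAt ℝ (fun u => l (g u)) y :=
      ((hg l).contDiffAt (hU.mem_nhds hy)).isSymmSndFDerivAt (by simpa using ENat.LEInfty.out)
    exact hs v w

end General

variable {n : ℕ}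

/-- `∑ dr_i ∧ ∂k/∂r_i` for a form depending on the base coordinates. -/
def dBase (k : (Fin n → ℝ) → Ext (Dar n)) (r : Fin n → ℝ) : Ext (Dar n) :=
  ∑ i, wedgeL (dr i) (partialD (Pi.single i 1) k r)

/-- `∑ ι_{∂/∂θ_i} ∂k/∂r_i` for a form depending on the base coordinates. -/
def dLamBase (k : (Fin n → ℝ) → Ext (Dar n)) (r : Fin n → ℝ) : Ext (Dar n) :=
  ∑ i, inter (eth i) (partialD (Pi.single i 1) k r)

/-- The imaginary part as a continuous linear map. -/
def imPartL (n : ℕ) : Cpx n →L[ℝ] (Fin n → ℝ) :=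
  ContinuousLinearMap.pi fun i => Complex.imCLM ∘L ContinuousLinearMap.proj i

theorem imPartL_apply (z : Cpx n) : imPartL n z = imPart z := rfl

theorem imPartL_ethC (i : Fin n) : imPartL n (ethC i) = 0 := by
  funext j
  simp [imPartL_apply, imPart, ethC, Pi.single_apply, apply_ite]

theorem imPartL_erC (i : Fin n) : imPartL n (erC i) = Pi.single i 1 := by
  funext j
  simp [imPartL_apply, imPart, erC, Pi.single_apply, apply_ite]

theorem partialD_zero {H W : Type*} [NormedAddCommGroup H] [NormedSpace ℝ H] [AddCommGroup W]
    [Module ℂ W] [Module.Finite ℂ W] (f : H → W) (y : H) : partialD 0 f y = 0 := by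
  simp [partialD]

variable {U : Set (Fin n → ℝ)}

theorem dLoc_invariant (hU : IsOpen U) {k : (Fin n → ℝ) → Ext (Dar n)} (hk : SmoothOn k U)
    {h : Dar n → Ext (Dar n)} (hh : ∀ y : Dar n, y.1 ∈ U → h y = k y.1) {y : Dar n}
    (hy : y.1 ∈ U) : dLoc h y = dBase k y.1 := by
  have key : ∀ v : Dar n, partialD v h y = partialD v.1 k y.1 := fun v => by
    have h1 : partialD v h y = partialD v (fun u => k u.1) y :=
      partialD_congr (U := Prod.fst ⁻¹' U) (hU.preimage continuous_fst) hh hy v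
    have h2 := partialD_comp hU hk LinearMap.id
      (ContinuousLinearMap.fst ℝ (Fin n → ℝ) (Fin n → ℝ)) (y := y) hy v
    simpa only [LinearMap.id_apply, ContinuousLinearMap.coe_fst', ← h1] using h2
  simp only [dLoc, key, dBase, er, eth, partialD_zero, map_zero, Finset.sum_const_zero, add_zero]

theorem smoothOn_dBase (hU : IsOpen U) {k : (Fin n → ℝ) → Ext (Dar n)} (hk : SmoothOn k U) :
    SmoothOn (dBase k) U :=
  SmoothOn.sum _ fun i => (hk.partialD hU (Pi.single i 1)).linear (wedgeL (dr i))

theorem smoothOn_dLamBase (hU : IsOpen U) {k : (Fin n → ℝ) → Ext (Dar n)} (hk : SmoothOn k U) :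
    SmoothOn (dLamBase k) U :=
  SmoothOn.sum _ fun i => (hk.partialD hU (Pi.single i 1)).linear (inter (eth i))

theorem inter_wedgeL {V : Type*} [AddCommGroup V] [Module ℝ V] (v : V) (α : V →ₗ[ℝ] ℂ) (x : Ext V) :
    inter v (wedgeL α x) = α v • x - wedgeL α (inter v x) :=
  contr_ι_mul (evalAt v) α x

/-- The commutator of `dr_i ∧` with the dual Lefschetz operator is contraction with `∂/∂θ_i`. -/
theorem lefDual_wedgeL_dr (i : Fin n) (x : Ext (Dar n)) :
    lefDual (wedgeL (dr i) x) = wedgeL (dr i) (lefDual x) - inter (eth i) x := by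
  simp only [lefDual, LinearMap.sum_apply, LinearMap.comp_apply, map_sum]
  have h : ∀ j, inter (er j) (inter (eth j) (wedgeL (dr i) x)) =
      wedgeL (dr i) (inter (er j) (inter (eth j) x)) - if i = j then inter (eth j) x else 0 := by
    intro j
    rw [inter_wedgeL, dr_eth, zero_smul, zero_sub, map_neg, inter_wedgeL, dr_er, neg_sub]
    split_ifs <;> simp
  simp only [h, Finset.sum_sub_distrib, Finset.sum_ite_eq, Finset.mem_univ, if_true]

theorem dLamLoc_invariant (hU : IsOpen U) {k : (Fin n → ℝ) → Ext (Dar n)} (hk : SmoothOn k U)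
    {h : Dar n → Ext (Dar n)} (hh : ∀ y : Dar n, y.1 ∈ U → h y = k y.1) {y : Dar n}
    (hy : y.1 ∈ U) : dLamLoc h y = dLamBase k y.1 := by
  rw [dLamLoc, dLoc_invariant hU hk hh hy, dLoc_invariant hU (hk.linear lefDual)
    (fun y hy => by rw [hh y hy]) hy]
  have key : ∀ v, partialD v (fun u => lefDual (k u)) y.1 = lefDual (partialD v k y.1) := fun v =>
    partialD_comp hU hk lefDual (ContinuousLinearMap.id ℝ _) hy v
  simp only [dBase, key, map_sum, lefDual_wedgeL_dr, dLamBase, ← Finset.sum_sub_distrib,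
    sub_sub_cancel]

/-- `d d^Λ = - d^Λ d` on invariant forms. -/
theorem dLamBase_dBase (hU : IsOpen U) {k : (Fin n → ℝ) → Ext (Dar n)} (hk : SmoothOn k U)
    {r : Fin n → ℝ} (hr : r ∈ U) : dLamBase (dBase k) r = -dBase (dLamBase k) r := by
  have h1 : ∀ v, partialD v (dBase k) r =
      ∑ j, wedgeL (dr j) (partialD v (partialD (Pi.single j 1) k) r) := fun v =>
    partialD_sum_linear hU (fun j => hk.partialD hU _) _ hr v
  have h2 : ∀ v, partialD v (dLamBase k) r =
      ∑ j, inter (eth j) (partialD v (partialD (Pi.single j 1) k) r) := fun v =>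
    partialD_sum_linear hU (fun j => hk.partialD hU _) _ hr v
  rw [dLamBase, dBase]
  simp only [h1, h2, map_sum, inter_wedgeL, dr_eth, zero_smul, zero_sub, Finset.sum_neg_distrib]
  rw [Finset.sum_comm]
  simp only [partialD_comm hU hk hr]

theorem partialD_invariant (hU : IsOpen U) {g : (Fin n → ℝ) → Ext (Cpx n)} (hg : SmoothOn g U)
    {f : Cpx n → Ext (Cpx n)} (hf : ∀ z, imPart z ∈ U → f z = g (imPart z)) {z : Cpx n}
    (hz : imPart z ∈ U) (v : Cpx n) : partialD v f z = partialD (imPartL n v) g (imPart z) := by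
  rw [partialD_congr (hU.preimage (imPartL n).continuous) hf hz]
  exact partialD_comp hU hg LinearMap.id (imPartL n) hz v

/-- The Fourier-Mukai transform takes `∂` to a multiple of `d^Λ`. -/
theorem ftLin_delLoc (hU : IsOpen U) {g : (Fin n → ℝ) → Ext (Cpx n)} (hg : SmoothOn g U)
    {f : Cpx n → Ext (Cpx n)} (hf : ∀ z, imPart z ∈ U → f z = g (imPart z)) {z : Cpx n}
    (hz : imPart z ∈ U) : ftLin (delLoc f z) =
      ((-1) ^ n * (Complex.I / 2)) • dLamBase (fun r => ftLin (g r)) (imPart z) := by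
  have key : ∀ v, partialD v (fun u => ftLin (g u)) (imPart z) =
      ftLin (partialD v g (imPart z)) := fun v =>
    partialD_comp hU hg ftLin (ContinuousLinearMap.id ℝ _) hz v
  simp only [delLoc, partialD_invariant hU hg hf hz, imPartL_ethC, imPartL_erC, partialD_zero,
    map_sum, ftLin_dz_mul, dLamBase, key, Finset.smul_sum]
  refine Finset.sum_congr rfl fun i _ => ?_
  simp only [zero_sub, map_neg, map_smul]
  module

/-- The Fourier-Mukai transform takes `∂̄` to a multiple of `d`. -/
theorem ftLin_delbarLoc (hU : IsOpen U) {g : (Fin n → ℝ) → Ext (Cpx n)} (hg : SmoothOn g U)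
    {f : Cpx n → Ext (Cpx n)} (hf : ∀ z, imPart z ∈ U → f z = g (imPart z)) {z : Cpx n}
    (hz : imPart z ∈ U) : ftLin (delbarLoc f z) =
      ((-1) ^ n * (Complex.I / 2)) • dBase (fun r => ftLin (g r)) (imPart z) := by
  have key : ∀ v, partialD v (fun u => ftLin (g u)) (imPart z) =
      ftLin (partialD v g (imPart z)) := fun v =>
    partialD_comp hU hg ftLin (ContinuousLinearMap.id ℝ _) hz v
  simp only [delbarLoc, partialD_invariant hU hg hf hz, imPartL_ethC, imPartL_erC, partialD_zero,
    map_sum, ftLin_dzbar_mul, dBase, key, Finset.smul_sum]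
  refine Finset.sum_congr rfl fun i _ => ?_
  simp only [zero_add, map_smul]
  module

/-- `d = ∂ + ∂̄`. -/
theorem dCLoc_eq (f : Cpx n → Ext (Cpx n)) (z : Cpx n) :
    dCLoc f z = delLoc f z + delbarLoc f z := by
  have hadd : ∀ (α β : Cpx n →ₗ[ℝ] ℂ) (x : Ext (Cpx n)),
      wedgeL (α + β) x = wedgeL α x + wedgeL β x := fun α β x => by
    simp [wedgeL, add_mul]
  have hsub : ∀ (α β : Cpx n →ₗ[ℝ] ℂ) (x : Ext (Cpx n)),
      wedgeL (α - β) x = wedgeL α x - wedgeL β x := fun α β x => by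
    simp [wedgeL, sub_mul]
  have hsmul : ∀ (c : ℂ) (α : Cpx n →ₗ[ℝ] ℂ) (x : Ext (Cpx n)),
      wedgeL (c • α) x = c • wedgeL α x := fun c α x => by
    simp [wedgeL]
  simp only [dCLoc, delLoc, delbarLoc, ← Finset.sum_add_distrib]
  refine Finset.sum_congr rfl fun i _ => ?_
  rw [dthC_eq, drC_eq]
  simp only [hadd, hsub, hsmul, map_smul, map_sub, map_add]
  module

/-- The Fourier-Mukai transform takes `d` on the mirror to a multiple of `d + d^Λ`. -/
theorem ftLin_dCLoc (hU : IsOpen U) {g : (Fin n → ℝ) → Ext (Cpx n)} (hg : SmoothOn g U)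
    {f : Cpx n → Ext (Cpx n)} (hf : ∀ z, imPart z ∈ U → f z = g (imPart z))
    {h : Dar n → Ext (Dar n)} (hh : ∀ y : Dar n, y.1 ∈ U → h y = ftLin (g y.1))
    {z : Cpx n} {y : Dar n} (hy : y.1 ∈ U) (hzy : imPart z = y.1) :
    ftLin (dCLoc f z) = ((-1) ^ n * (Complex.I / 2)) • (dLoc h y + dLamLoc h y) := by
  rw [dCLoc_eq, map_add, ftLin_delLoc hU hg hf (hzy ▸ hy), ftLin_delbarLoc hU hg hf (hzy ▸ hy),
    dLoc_invariant hU (hg.linear ftLin) hh hy, dLamLoc_invariant hU (hg.linear ftLin) hh hy, hzy,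
    smul_add, add_comm]

/-- The Fourier-Mukai transform takes `∂ ∂̄` to a multiple of `d d^Λ`. -/
theorem ftLin_delLoc_delbarLoc (hU : IsOpen U) {g : (Fin n → ℝ) → Ext (Cpx n)} (hg : SmoothOn g U)
    {f : Cpx n → Ext (Cpx n)} (hf : ∀ z, imPart z ∈ U → f z = g (imPart z))
    {h : Dar n → Ext (Dar n)} (hh : ∀ y : Dar n, y.1 ∈ U → h y = ftLin (g y.1))
    {z : Cpx n} {y : Dar n} (hy : y.1 ∈ U) (hzy : imPart z = y.1) :
    ftLin (delLoc (delbarLoc f) z) = (1 / 4 : ℂ) • dLoc (dLamLoc h) y := by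
  set k : (Fin n → ℝ) → Ext (Dar n) := fun r => ftLin (g r) with hkdef
  have hk : SmoothOn k U := hg.linear ftLin
  -- the coefficient form of `∂̄ f` on the base
  set g' : (Fin n → ℝ) → Ext (Cpx n) := fun r => ∑ i, wedgeL (dzbar i)
    ((Complex.I / 2) • partialD (Pi.single i 1) g r) with hg'def
  have hg' : SmoothOn g' U :=
    SmoothOn.sum _ fun i => ((hg.partialD hU (Pi.single i 1)).smul _).linear (wedgeL (dzbar i))
  have hf' : ∀ z, imPart z ∈ U → delbarLoc f z = g' (imPart z) := by
    intro z hz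
    simp only [delbarLoc, partialD_invariant hU hg hf hz, imPartL_ethC, imPartL_erC, partialD_zero,
      zero_add, hg'def, smul_smul]
    refine Finset.sum_congr rfl fun i _ => ?_
    congr 2
    ring
  have hz : imPart z ∈ U := hzy ▸ hy
  have hkg' : ∀ r ∈ U, ftLin (g' r) = ((-1) ^ n * (Complex.I / 2)) • dBase k r := by
    intro r hr
    have hr' : imPart (mkCpx r 0) = r := by
      funext i
      simp [imPart, mkCpx]
    have h1 := ftLin_delbarLoc hU hg hf (z := mkCpx r 0) (hr'.symm ▸ hr)
    rwa [hf' _ (hr'.symm ▸ hr), hr'] at h1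
  have h2 : dLamBase (fun r => ftLin (g' r)) (imPart z) =
      ((-1) ^ n * (Complex.I / 2)) • dLamBase (dBase k) (imPart z) := by
    simp only [dLamBase, Finset.smul_sum]
    refine Finset.sum_congr rfl fun i _ => ?_
    rw [partialD_congr hU hkg' hz, partialD_smul hU (smoothOn_dBase hU hk) _ hz, map_smul]
  have hsq : ((-1 : ℂ) ^ n * (Complex.I / 2)) * ((-1) ^ n * (Complex.I / 2)) = -(1 / 4) := by
    have h1 : ((-1 : ℂ) ^ n) * (-1) ^ n = 1 := by rw [← mul_pow]; simp
    linear_combination (Complex.I * Complex.I / 4) * h1 + Complex.I_mul_I / 4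
  rw [ftLin_delLoc hU hg' hf' hz, h2, smul_smul, hsq, dLamBase_dBase hU hk hz,
    dLoc_invariant hU (smoothOn_dLamBase hU hk) (fun y hy => dLamLoc_invariant hU hk hh hy) hy,
    hzy]
  simp

end InvariantCalculus

/-! ### Forms and their local expressions -/

section Gluing

variable {E : Type*} [AddCommGroup E] [Module ℝ E] {J Y : Type*}

theorem pull_pull {V W Z : Type*} [AddCommGroup V] [Module ℝ V] [AddCommGroup W] [Module ℝ W]
    [AddCommGroup Z] [Module ℝ Z] (f : V →ₗ[ℝ] W) (g : W →ₗ[ℝ] Z) (x : Ext Z) :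
    pull f (pull g x) = pull (g ∘ₗ f) x := by
  change ((ExteriorAlgebra.map (pull1 f)).comp (ExteriorAlgebra.map (pull1 g))) x = _
  rw [ExteriorAlgebra.map_comp_map]
  rfl

theorem pull_id {V : Type*} [AddCommGroup V] [Module ℝ V] (x : Ext V) :
    pull (LinearMap.id : V →ₗ[ℝ] V) x = x := by
  change ExteriorAlgebra.map (LinearMap.id : (V →ₗ[ℝ] ℂ) →ₗ[ℂ] _) x = x
  rw [ExteriorAlgebra.map_id]
  rfl

/-- Local expressions that are compatible on overlaps glue to a global form.  The tangent spaces
of the manifold `Y` are identified with the model space `E`, and `D a y` is the derivative of the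
parametrisation `par a`. -/
theorem exists_form_of_compatible (par : J → E → Y) (dom : J → Set E) (D : J → E → E →ₗ[ℝ] E)
    (hD : ∀ a, ∀ y ∈ dom a, ∃ G : E →ₗ[ℝ] E, G ∘ₗ D a y = LinearMap.id)
    (hsurj : ∀ p, ∃ a, ∃ y ∈ dom a, par a y = p) (F : J → E → Ext E)
    (hF : ∀ a a' y y', y ∈ dom a → y' ∈ dom a' → par a y = par a' y' →
      ∃ L : E →ₗ[ℝ] E, D a y = D a' y' ∘ₗ L ∧ F a y = pull L (F a' y')) :
    ∃ φ : Y → Ext E, ∀ a, ∀ y ∈ dom a, pull (D a y) (φ (par a y)) = F a y := by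
  choose a y hy hpar using hsurj
  choose G hG using fun p => hD (a p) (y p) (hy p)
  refine ⟨fun p => pull (G p) (F (a p) (y p)), fun b u hu => ?_⟩
  obtain ⟨L, hL, h⟩ := hF b (a (par b u)) u (y (par b u)) hu (hy _) (hpar _).symm
  rw [pull_pull, hL, ← LinearMap.comp_assoc, hG, LinearMap.id_comp, h]

/-- A form is determined by its local expressions. -/
theorem form_ext_of_local (par : J → E → Y) (dom : J → Set E) (D : J → E → E →ₗ[ℝ] E)
    (hD : ∀ a, ∀ y ∈ dom a, ∃ G : E →ₗ[ℝ] E, D a y ∘ₗ G = LinearMap.id)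
    (hsurj : ∀ p, ∃ a, ∃ y ∈ dom a, par a y = p) {φ ψ : Y → Ext E}
    (h : ∀ a, ∀ y ∈ dom a, pull (D a y) (φ (par a y)) = pull (D a y) (ψ (par a y))) : φ = ψ := by
  funext p
  obtain ⟨a, y, hy, rfl⟩ := hsurj p
  obtain ⟨G, hG⟩ := hD a y hy
  have h1 := congrArg (pull G) (h a y hy)
  rwa [pull_pull, pull_pull, hG, pull_id, pull_id] at h1

end Gluing

section Derivative

variable {𝕜 E Y : Type*} [NontriviallyNormedField 𝕜] [NormedAddCommGroup E] [NormedSpace 𝕜 E]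
  [TopologicalSpace Y] [ChartedSpace E Y]

/-- The derivative of a parametrisation, with the tangent spaces of the manifold identified with
the model space. -/
def parDeriv (𝕜 : Type*) {E Y : Type*} [NontriviallyNormedField 𝕜] [NormedAddCommGroup E]
    [NormedSpace 𝕜 E] [TopologicalSpace Y] [ChartedSpace E Y] (f : E → Y) (y : E) : E →L[𝕜] E :=
  mfderiv 𝓘(𝕜, E) 𝓘(𝕜, E) f y

/-- Two parametrisations that differ by an affine change of coordinates near a point have
derivatives there that differ by its linear part. -/
theorem parDeriv_eq_comp {f f' : E → Y} {y y' : E} (L : E →L[𝕜] E)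
    (hf' : MDifferentiableAt 𝓘(𝕜, E) 𝓘(𝕜, E) f' y')
    (h : ∀ᶠ u in nhds (0 : E), f (y + u) = f' (y' + L u)) :
    parDeriv 𝕜 f y = parDeriv 𝕜 f' y' ∘L L := by
  obtain ⟨ψ, hψ⟩ : ∃ ψ : E → E, ψ = fun u => y' + L (u - y) := ⟨_, rfl⟩
  have hy' : y' = ψ y := by simp [hψ]
  have hd : HasFDerivAt ψ L y := by
    rw [hψ]
    exact (L.hasFDerivAt.comp y ((hasFDerivAt_id y).sub_const y)).const_add y'
  have hev : f =ᶠ[nhds y] f' ∘ ψ := by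
    have ht : Filter.Tendsto (fun u => u - y) (nhds y) (nhds 0) :=
      (continuous_sub_right y).tendsto' y 0 (sub_self y)
    filter_upwards [ht.eventually h] with u hu
    simpa [hψ] using hu
  rw [hy'] at hf' ⊢
  have h1 := (hf'.hasMFDerivAt.comp y hd.hasMFDerivAt).congr_of_eventuallyEq hev
  exact h1.mfderiv

/-- The derivative of a local diffeomorphism is invertible. -/
theorem exists_parDeriv_inverse {f : E → Y} {y : E} {m : WithTop ℕ∞}
    (hf : IsLocalDiffeomorphAt 𝓘(𝕜, E) 𝓘(𝕜, E) m f y) (hm : m ≠ 0) :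
    ∃ G : E →L[𝕜] E, G ∘L parDeriv 𝕜 f y = ContinuousLinearMap.id 𝕜 E ∧
      parDeriv 𝕜 f y ∘L G = ContinuousLinearMap.id 𝕜 E := by
  let e : E ≃L[𝕜] E := hf.mfderivToContinuousLinearEquiv hm
  have he : parDeriv 𝕜 f y = e := (hf.mfderivToContinuousLinearEquiv_coe hm).symm
  refine ⟨e.symm, ?_, ?_⟩
  · rw [he]
    exact ContinuousLinearMap.ext e.symm_apply_apply
  · rw [he]
    exact ContinuousLinearMap.ext e.apply_symm_apply

end Derivative

/-! ### Changes of coordinates on the two torus bundles -/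

section Transition

variable {n : ℕ} {ι B X : Type*} [TopologicalSpace B] [TopologicalSpace X] [ChartedSpace (Dar n) X]
  {σ : ∀ x : X, TangentSpace 𝓘(ℝ, Dar n) x →ₗ[ℝ] TangentSpace 𝓘(ℝ, Dar n) x →ₗ[ℝ] ℝ}
  (S : TorusBundle n ι B X σ)

/-- The transformation rule for local expressions under a change of action-angle coordinates. -/
theorem TorusBundle.rep_eq_pull {a a' : ι} {y y' : Dar n} {L : Dar n →ₗ[ℝ] Dar n}
    (h : S.par a y = S.par a' y') (hD : (parDeriv ℝ (S.par a) y).toLinearMap =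
      (parDeriv ℝ (S.par a') y').toLinearMap ∘ₗ L) (φ : Form n X) :
    S.rep a φ y = pull L (S.rep a' φ y') := by
  have key : ∀ ψ : X → Ext (Dar n), pull (parDeriv ℝ (S.par a) y).toLinearMap (ψ (S.par a y)) =
      pull L (pull (parDeriv ℝ (S.par a') y').toLinearMap (ψ (S.par a' y'))) := fun ψ => by
    rw [pull_pull, hD, h]
  exact key φ

theorem TorusBundle.exists_par (x : X) : ∃ a, ∃ y ∈ S.dom a, S.par a y = x := by
  obtain ⟨a, ha⟩ := S.cover (S.proj x)
  obtain ⟨θ, h⟩ := S.par_surj a x ha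
  exact ⟨a, _, (S.chart a).map_source ha, h⟩

theorem TorusBundle.exists_inverse (a : ι) {y : Dar n} (hy : y ∈ S.dom a) :
    ∃ G : Dar n →L[ℝ] Dar n, G ∘L parDeriv ℝ (S.par a) y = ContinuousLinearMap.id ℝ _ ∧
      parDeriv ℝ (S.par a) y ∘L G = ContinuousLinearMap.id ℝ _ :=
  exists_parDeriv_inverse (S.isLocalDiffeo a ⟨y, hy⟩) (by simp)

/-- A linear part of a change of action coordinates serves at all nearby points. -/
theorem TorusBundle.HasLinearPart.eventually {S : TorusBundle n ι B X σ} {a a' : ι} {b : B}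
    {A : Matrix.SpecialLinearGroup (Fin n) ℤ} (h : S.HasLinearPart a a' b A) :
    ∀ᶠ b' in nhds b, S.HasLinearPart a a' b' A := by
  have h' := eventually_eventually_nhds.2 h
  filter_upwards [h'] with b' hb'
  filter_upwards [hb'] with b'' hb''
  rw [hb'', hb'.self_of_nhds, add_assoc]
  have hadd : ∀ u v, act A u + act A v = act A (u + v) := fun u v =>
    (Matrix.mulVec_add _ u v).symm
  rw [hadd]
  congr 2
  abel

/-- The linear part of a change of action-angle coordinates: it is the derivative of that change,
and the base coordinates change by the matrix `A`. -/
theorem TorusBundle.exists_linearPart {a a' : ι} {y y' : Dar n} (hy : y ∈ S.dom a)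
    (hy' : y' ∈ S.dom a') (h : S.par a y = S.par a' y') :
    ∃ A, (S.chart a).symm y.1 ∈ (S.chart a').source ∧
      S.chart a' ((S.chart a).symm y.1) = y'.1 ∧
      S.HasLinearPart a a' ((S.chart a).symm y.1) A ∧
      (parDeriv ℝ (S.par a) y).toLinearMap =
        (parDeriv ℝ (S.par a') y').toLinearMap ∘ₗ darMap A := by
  obtain ⟨A, hA⟩ := S.transition a a' y y' hy hy' h
  have hb : (S.chart a).symm y.1 = (S.chart a').symm y'.1 := by
    rw [← S.proj_par a y.1 hy y.2, ← S.proj_par a' y'.1 hy' y'.2]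
    exact congrArg S.proj h
  have hbs : (S.chart a).symm y.1 ∈ (S.chart a').source := by
    rw [hb]
    exact (S.chart a').map_target hy'
  have hba : (S.chart a).symm y.1 ∈ (S.chart a).source := (S.chart a).map_target hy
  have hca : S.chart a ((S.chart a).symm y.1) = y.1 := (S.chart a).right_inv hy
  have hcb : S.chart a' ((S.chart a).symm y.1) = y'.1 := by
    rw [hb]
    exact (S.chart a').right_inv hy'
  refine ⟨A, hbs, hcb, ?_, ?_⟩
  · have ht : Filter.Tendsto (fun b' => ((S.chart a b' - y.1, 0) : Dar n))
        (nhds ((S.chart a).symm y.1)) (nhds 0) := by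
      have h1 : Filter.Tendsto (fun b' => S.chart a b' - y.1) (nhds ((S.chart a).symm y.1))
          (nhds 0) := by
        have := ((S.chart a).continuousAt hba).tendsto.sub_const y.1
        rwa [hca, sub_self] at this
      exact h1.prodMk_nhds tendsto_const_nhds
    have hev := ht.eventually hA
    have hopen : ∀ᶠ h : Dar n in nhds 0, y' + darMap A h ∈ S.dom a' := by
      have hc : Continuous fun h : Dar n => y' + darMap A h :=
        continuous_const.add (darMap A).continuous_of_finiteDimensional
      exact hc.continuousAt.eventually_mem ((S.isOpen_dom a').mem_nhds (by simpa using hy'))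
    filter_upwards [hev, ht.eventually hopen, (S.chart a).open_source.mem_nhds hba] with b' h1 h2 h3
    rw [hca, hcb]
    have hmem : y.1 + (S.chart a b' - y.1) ∈ (S.chart a).target := by
      rw [add_sub_cancel]
      exact (S.chart a).map_source h3
    have h4 := congrArg S.proj h1
    have h5 := S.proj_par a (y.1 + (S.chart a b' - y.1)) hmem (y.2 + 0)
    have h6 := S.proj_par a' (y'.1 + act A (S.chart a b' - y.1)) h2 (y'.2 + coact A 0)
    have h7 : (S.chart a).symm (y.1 + (S.chart a b' - y.1)) =
        (S.chart a').symm (y'.1 + act A (S.chart a b' - y.1)) := h5.symm.trans (h4.trans h6)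
    rw [add_sub_cancel, (S.chart a).left_inv h3] at h7
    conv_lhs => rw [h7]
    exact (S.chart a').right_inv h2
  · have hd := (S.isLocalDiffeo a' ⟨y', hy'⟩).mdifferentiableAt (by simp)
    have h1 := parDeriv_eq_comp (LinearMap.toContinuousLinearMap (darMap A)) hd hA
    rw [h1]
    rfl

variable {Xc : Type*} [TopologicalSpace Xc] [ChartedSpace (Cpx n) Xc] {S} (M : Mirror S Xc)

/-- The transformation rule for local expressions under a change of complex coordinates. -/
theorem Mirror.rep_eq_pull {a a' : ι} {z z' : Cpx n} {L : Cpx n →ₗ[ℂ] Cpx n}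
    (h : M.par a z = M.par a' z') (hD : (parDeriv ℂ (M.par a) z).toLinearMap =
      (parDeriv ℂ (M.par a') z').toLinearMap ∘ₗ L) (φ : CForm n Xc) :
    M.rep a φ z = pull (L.restrictScalars ℝ) (M.rep a' φ z') := by
  have key : ∀ ψ : Xc → Ext (Cpx n),
      pull ((parDeriv ℂ (M.par a) z).toLinearMap.restrictScalars ℝ) (ψ (M.par a z)) =
        pull (L.restrictScalars ℝ) (pull
          ((parDeriv ℂ (M.par a') z').toLinearMap.restrictScalars ℝ) (ψ (M.par a' z'))) :=
    fun ψ => by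
      rw [pull_pull, hD, h]
      rfl
  exact key φ

/-- The real part `θ̌` of `z = θ̌ + i r`. -/
abbrev rePart (z : Cpx n) : Fin n → ℝ := fun i => (z i).re

theorem mkCpx_imPart_rePart (z : Cpx n) : mkCpx (imPart z) (rePart z) = z := by
  funext i
  apply Complex.ext <;> simp

theorem imPart_mkCpx (r t : Fin n → ℝ) : imPart (mkCpx r t) = r := by
  funext i
  simp

theorem mkCpx_add (r t r' t' : Fin n → ℝ) : mkCpx r t + mkCpx r' t' = mkCpx (r + r') (t + t') := by
  funext i
  apply Complex.ext <;> simp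

theorem Mirror.exists_par (p : Xc) : ∃ a, ∃ z ∈ M.dom a, M.par a z = p := by
  obtain ⟨a, ha⟩ := S.cover (M.proj p)
  obtain ⟨t, h⟩ := M.par_surj a p ha
  refine ⟨a, _, ?_, h⟩
  change imPart (mkCpx _ t) ∈ (S.chart a).target
  rw [imPart_mkCpx]
  exact (S.chart a).map_source ha

theorem Mirror.exists_inverse (a : ι) {z : Cpx n} (hz : z ∈ M.dom a) :
    ∃ G : Cpx n →L[ℂ] Cpx n, G ∘L parDeriv ℂ (M.par a) z = ContinuousLinearMap.id ℂ _ ∧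
      parDeriv ℂ (M.par a) z ∘L G = ContinuousLinearMap.id ℂ _ :=
  exists_parDeriv_inverse (M.isLocalBihol a ⟨z, hz⟩) (by simp)

/-- Where the action coordinates change by `A`, the derivative of the change of complex coordinates
on the mirror is `A` as well. -/
theorem Mirror.parDeriv_eq {a a' : ι} {b : B} {A : Matrix.SpecialLinearGroup (Fin n) ℤ}
    (hb : b ∈ (S.chart a).source) (hb' : b ∈ (S.chart a').source) (hA : S.HasLinearPart a a' b A)
    {t t' : Fin n → ℝ}
    (h : M.par a (mkCpx (S.chart a b) t) = M.par a' (mkCpx (S.chart a' b) t')) :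
    (parDeriv ℂ (M.par a) (mkCpx (S.chart a b) t)).toLinearMap =
      (parDeriv ℂ (M.par a') (mkCpx (S.chart a' b) t')).toLinearMap ∘ₗ cpxMap A := by
  -- the two angle coordinates of the point agree up to a lattice vector `m`
  obtain ⟨m, hm⟩ : ∃ m : Fin n → ℤ, t' = act A t + fun i => (m i : ℝ) := by
    rw [← M.par_eq_iff a' _ ((S.chart a').map_source hb'), ← h]
    exact (M.transition a a' b A hb hb' hA t).symm
  have hz' : mkCpx (S.chart a' b) t' ∈ M.dom a' := by
    change imPart (mkCpx _ t') ∈ (S.chart a').target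
    rw [imPart_mkCpx]
    exact (S.chart a').map_source hb'
  have hd := (M.isLocalBihol a' ⟨_, hz'⟩).mdifferentiableAt (by simp)
  have hev : ∀ᶠ u in nhds (0 : Cpx n), M.par a (mkCpx (S.chart a b) t + u) =
      M.par a' (mkCpx (S.chart a' b) t' + LinearMap.toContinuousLinearMap (cpxMap A) u) := by
    have hlin : Filter.Tendsto (fun u : Cpx n => S.chart a b + imPart u) (nhds 0)
        (nhds (S.chart a b)) := by
      have hc : Continuous fun u : Cpx n => S.chart a b + imPart u :=
        continuous_const.add (imPartL n).continuous
      have h0 : S.chart a b + imPart (0 : Cpx n) = S.chart a b := by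
        have h00 : imPart (0 : Cpx n) = 0 := rfl
        rw [h00, add_zero]
      simpa only [h0] using hc.tendsto 0
    have ht : Filter.Tendsto (fun u : Cpx n => (S.chart a).symm (S.chart a b + imPart u)) (nhds 0)
        (nhds b) := by
      have hc := (S.chart a).continuousAt_symm ((S.chart a).map_source hb)
      rw [ContinuousAt, (S.chart a).left_inv hb] at hc
      exact hc.comp hlin
    filter_upwards [hlin.eventually ((S.chart a).open_target.mem_nhds ((S.chart a).map_source hb)),
      ht.eventually ((S.chart a').open_source.mem_nhds hb'), ht.eventually hA,
      ht.eventually hA.eventually] with u h1 h2 h3 h4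
    have h5 := M.transition a a' _ A ((S.chart a).map_target h1) h2 h4 (t + rePart u)
    rw [h3, (S.chart a).right_inv h1, add_sub_cancel_left] at h5
    have h6 : S.chart a' b + act A (imPart u) ∈ (S.chart a').target := by
      have h7 := (S.chart a').map_source h2
      rwa [h3, (S.chart a).right_inv h1, add_sub_cancel_left] at h7
    have h8 : act A (t + rePart u) + (fun i => (m i : ℝ)) = t' + act A (rePart u) := by
      rw [hm, show act A (t + rePart u) = act A t + act A (rePart u) from Matrix.mulVec_add _ _ _]
      abel
    have h9 := (M.par_eq_iff a' _ h6 (act A (t + rePart u)) (t' + act A (rePart u))).2 ⟨m, h8.symm⟩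
    have h10 : cpxMap A u = mkCpx (act A (imPart u)) (act A (rePart u)) := by
      rw [← cpxMap_mkCpx, mkCpx_imPart_rePart]
    rw [LinearMap.coe_toContinuousLinearMap', h10, mkCpx_add, ← h9, ← h5, ← mkCpx_add,
      mkCpx_imPart_rePart]
  have h1 := parDeriv_eq_comp (LinearMap.toContinuousLinearMap (cpxMap A)) hd hev
  rw [h1]
  rfl

end Transition

/-! ### The Fourier-Mukai transform of a torus-invariant form -/

section Transform

variable {n : ℕ} {ι B X : Type*} [TopologicalSpace B] [TopologicalSpace X] [ChartedSpace (Dar n) X]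
  {σ : ∀ x : X, TangentSpace 𝓘(ℝ, Dar n) x →ₗ[ℝ] TangentSpace 𝓘(ℝ, Dar n) x →ₗ[ℝ] ℝ}
  {S : TorusBundle n ι B X σ} {Xc : Type*} [TopologicalSpace Xc] [ChartedSpace (Cpx n) Xc]
  (M : Mirror S Xc)

theorem TorusBundle.form_ext (S : TorusBundle n ι B X σ) {φ ψ : Form n X}
    (h : ∀ a, ∀ y ∈ S.dom a, S.rep a φ y = S.rep a ψ y) : φ = ψ := by
  refine form_ext_of_local (E := Dar n) S.par S.dom
    (fun a y => (parDeriv ℝ (S.par a) y).toLinearMap) (fun a y hy => ?_) S.exists_par h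
  obtain ⟨G, -, hG⟩ := S.exists_inverse a hy
  exact ⟨G.toLinearMap, congrArg ContinuousLinearMap.toLinearMap hG⟩

theorem Mirror.form_ext {φ ψ : CForm n Xc}
    (h : ∀ a, ∀ z ∈ M.dom a, M.rep a φ z = M.rep a ψ z) : φ = ψ := by
  refine form_ext_of_local (E := Cpx n) M.par M.dom
    (fun a z => (parDeriv ℂ (M.par a) z).toLinearMap.restrictScalars ℝ) (fun a z hz => ?_)
    M.exists_par h
  obtain ⟨G, -, hG⟩ := M.exists_inverse a hz
  exact ⟨G.toLinearMap.restrictScalars ℝ,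
    congrArg (fun f => f.toLinearMap.restrictScalars ℝ) hG⟩

/-- The section `r ↦ i r` of the imaginary part, as a continuous linear map. -/
def imLift (n : ℕ) : (Fin n → ℝ) →L[ℝ] Cpx n :=
  ContinuousLinearMap.pi fun i =>
    (Complex.I • Complex.ofRealCLM) ∘L ContinuousLinearMap.proj i

theorem imLift_apply (r : Fin n → ℝ) : imLift n r = mkCpx r 0 := by
  funext i
  simp [imLift]

theorem mem_dom_mkCpx {a : ι} {r : Fin n → ℝ} (hr : r ∈ (S.chart a).target) (t : Fin n → ℝ) :
    mkCpx r t ∈ M.dom a := by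
  change imPart (mkCpx r t) ∈ (S.chart a).target
  rwa [imPart_mkCpx]

/-- The coefficient form of an invariant form on the mirror, as a function on the base. -/
theorem Mirror.smoothOn_base {φc : CForm n Xc} (hφ : φc ∈ M.invForms) (a : ι) :
    SmoothOn (fun r => M.rep a φc (mkCpx r 0)) (S.chart a).target := by
  have h := (hφ a).1.comp_clm (imLift n) (V := (S.chart a).target) fun r hr => by
    rw [imLift_apply]
    exact mem_dom_mkCpx M hr 0
  simpa only [imLift_apply] using h

theorem Mirror.rep_eq_base {φc : CForm n Xc} (hφ : φc ∈ M.invForms) (a : ι) (z : Cpx n)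
    (hz : imPart z ∈ (S.chart a).target) : M.rep a φc z = M.rep a φc (mkCpx (imPart z) 0) := by
  conv_lhs => rw [← mkCpx_imPart_rePart z]
  exact (hφ a).2 _ hz _ _

theorem Mirror.isFourierMukai_iff {φc : CForm n Xc} (hφ : φc ∈ M.invForms) (φ : Form n X) :
    M.IsFourierMukai φc φ ↔
      ∀ a, ∀ y ∈ S.dom a, S.rep a φ y = ftLin (M.rep a φc (mkCpx y.1 0)) := by
  refine forall_congr' fun a => forall₂_congr fun y hy => ?_
  rw [ftLoc_eq ((hφ a).2 y.1 hy)]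

theorem Mirror.isFourierMukaiInv_iff {φ : Form n X} (hφ : φ ∈ S.invForms) (φc : CForm n Xc) :
    M.IsFourierMukaiInv φ φc ↔
      ∀ a, ∀ z ∈ M.dom a, M.rep a φc z = ftInvLin (S.rep a φ (imPart z, 0)) := by
  refine forall_congr' fun a => forall₂_congr fun z hz => ?_
  rw [ftInvLoc_eq ((hφ a).2 (imPart z) hz)]

/-- The local Fourier-Mukai transforms of an invariant form on the mirror glue. -/
theorem Mirror.exists_isFourierMukai {φc : CForm n Xc} (hφ : φc ∈ M.invForms) :
    ∃ φ ∈ S.invForms, M.IsFourierMukai φc φ := by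
  obtain ⟨φ, h⟩ := exists_form_of_compatible (E := Dar n) S.par S.dom
    (fun a y => (parDeriv ℝ (S.par a) y).toLinearMap)
    (fun a y hy => by
      obtain ⟨G, hG, -⟩ := S.exists_inverse a hy
      exact ⟨G.toLinearMap, congrArg ContinuousLinearMap.toLinearMap hG⟩)
    S.exists_par (fun a y => ftLin (M.rep a φc (mkCpx y.1 0)))
    (fun a a' y y' hy hy' hyy' => by
      obtain ⟨A, hbs, hcb, hA, hD⟩ := S.exists_linearPart hy hy' hyy'
      refine ⟨darMap A, hD, ?_⟩
      have hba := (S.chart a).map_target hy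
      have hca : S.chart a ((S.chart a).symm y.1) = y.1 := (S.chart a).right_inv hy
      have ht := M.transition a a' _ A hba hbs hA 0
      have hd := M.parDeriv_eq hba hbs hA ht
      rw [hca, hcb] at hd ht
      rw [← ftLin_pull, (hφ a').2 y'.1 hy' 0 (act A 0), ← M.rep_eq_pull ht hd])
  have hrep : ∀ a, ∀ y ∈ S.dom a, S.rep a φ y = ftLin (M.rep a φc (mkCpx y.1 0)) := h
  refine ⟨φ, fun a => ⟨?_, fun r hr θ θ' => ?_⟩, (M.isFourierMukai_iff hφ φ).2 hrep⟩
  · exact (((M.smoothOn_base hφ a).comp_clm (ContinuousLinearMap.fst ℝ (Fin n → ℝ) (Fin n → ℝ))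
      (V := S.dom a) fun y hy => hy).linear ftLin).congr (hrep a)
  · rw [hrep a (r, θ) hr, hrep a (r, θ') hr]

/-- The local Fourier-Mukai transforms of an invariant form on the symplectic side glue. -/
theorem Mirror.exists_isFourierMukaiInv {φ : Form n X} (hφ : φ ∈ S.invForms) :
    ∃ φc ∈ M.invForms, M.IsFourierMukaiInv φ φc := by
  obtain ⟨φc, h⟩ := exists_form_of_compatible (E := Cpx n) M.par M.dom
    (fun a z => (parDeriv ℂ (M.par a) z).toLinearMap.restrictScalars ℝ)
    (fun a z hz => by
      obtain ⟨G, hG, -⟩ := M.exists_inverse a hz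
      exact ⟨G.toLinearMap.restrictScalars ℝ,
        congrArg (fun f => f.toLinearMap.restrictScalars ℝ) hG⟩)
    M.exists_par (fun a z => ftInvLin (S.rep a φ (imPart z, 0)))
    (fun a a' z z' hz hz' hzz' => by
      have hb : (S.chart a).symm (imPart z) = (S.chart a').symm (imPart z') := by
        rw [← M.proj_par a z hz, ← M.proj_par a' z' hz', hzz']
      have hproj := S.proj_par a (imPart z) hz 0
      have hbs : (S.chart a).symm (imPart z) ∈ (S.chart a').source := by
        rw [hb]
        exact (S.chart a').map_target hz'
      -- a point of `X` over the same base point provides the matrix of the change of coordinates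
      obtain ⟨θ', hθ'⟩ := S.par_surj a' (S.par a (imPart z, 0)) (by rwa [hproj])
      have hr' : S.chart a' ((S.chart a).symm (imPart z)) = imPart z' := by
        rw [hb]
        exact (S.chart a').right_inv hz'
      rw [hproj, hr'] at hθ'
      obtain ⟨A, -, -, hA, hD⟩ := S.exists_linearPart (y := (imPart z, 0)) (y' := (imPart z', θ'))
        hz hz' hθ'.symm
      refine ⟨(cpxMap A).restrictScalars ℝ, ?_, ?_⟩
      · have hca : S.chart a ((S.chart a).symm (imPart z)) = imPart z := (S.chart a).right_inv hz
        have hd := M.parDeriv_eq ((S.chart a).map_target hz) hbs hA (t := rePart z)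
          (t' := rePart z') (by
            rw [hca, hr', mkCpx_imPart_rePart, mkCpx_imPart_rePart, hzz'])
        rw [hca, hr', mkCpx_imPart_rePart, mkCpx_imPart_rePart] at hd
        exact congrArg (fun f => f.restrictScalars ℝ) hd
      · rw [← ftInvLin_pull, (hφ a').2 (imPart z') hz' 0 θ', ← S.rep_eq_pull hθ'.symm hD])
  have hrep : ∀ a, ∀ z ∈ M.dom a, M.rep a φc z = ftInvLin (S.rep a φ (imPart z, 0)) := h
  refine ⟨φc, fun a => ⟨?_, fun r hr t t' => ?_⟩, (M.isFourierMukaiInv_iff hφ φc).2 hrep⟩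
  · exact (((hφ a).1.comp_clm ((ContinuousLinearMap.inl ℝ (Fin n → ℝ) (Fin n → ℝ)) ∘L imPartL n)
      (V := M.dom a) fun z hz => hz).linear ftInvLin).congr (hrep a)
  · rw [hrep a _ (mem_dom_mkCpx M hr t), hrep a _ (mem_dom_mkCpx M hr t'), imPart_mkCpx,
      imPart_mkCpx]

end Transform

/-! ### Comparison of the two complexes -/

section Comparison

variable {n : ℕ} {ι B X : Type*} [TopologicalSpace B] [TopologicalSpace X] [ChartedSpace (Dar n) X]
  {σ : ∀ x : X, TangentSpace 𝓘(ℝ, Dar n) x →ₗ[ℝ] TangentSpace 𝓘(ℝ, Dar n) x →ₗ[ℝ] ℝ}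
  {S : TorusBundle n ι B X σ} {Xc : Type*} [TopologicalSpace Xc] [ChartedSpace (Cpx n) Xc]
  {M : Mirror S Xc}

/-- Every invariant form on `X` is a Fourier-Mukai transform, namely of a multiple of its own
inverse transform. -/
theorem Mirror.exists_isFourierMukai_preimage {φ : Form n X} (hφ : φ ∈ S.invForms) :
    ∃ φc ∈ M.invForms, M.IsFourierMukai φc φ := by
  obtain ⟨ψ, hψ, h⟩ := M.exists_isFourierMukaiInv hφ
  rw [M.isFourierMukaiInv_iff hφ] at h
  obtain ⟨c, hc, hinv⟩ := exists_ftLin_ftInvLin (n := n)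
  have hmem := Submodule.smul_mem _ c⁻¹ hψ
  refine ⟨c⁻¹ • ψ, hmem, (M.isFourierMukai_iff hmem φ).2 fun a y hy => ?_⟩
  rw [M.rep_smul]
  beta_reduce
  rw [h a _ (mem_dom_mkCpx M hy 0), map_smul, hinv, smul_smul, inv_mul_cancel₀ hc,
    one_smul, imPart_mkCpx]
  exact (hφ a).2 y.1 hy _ _

/-- The two transforms are inverse to each other up to a constant, which depends on `n` only. -/
theorem Mirror.exists_isFourierMukaiInv_smul (M : Mirror S Xc) : ∃ c : ℂ, c ≠ 0 ∧
    ∀ φc ∈ M.invForms, ∀ φ ∈ S.invForms, M.IsFourierMukai φc φ →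
      M.IsFourierMukaiInv φ (c • φc) := by
  obtain ⟨c, hc, hinv⟩ := exists_ftInvLin_ftLin (n := n)
  refine ⟨c, hc, fun φc hφc φ hφ h => (M.isFourierMukaiInv_iff hφ _).2 fun a z hz => ?_⟩
  rw [M.isFourierMukai_iff hφc] at h
  rw [M.rep_smul, h a (imPart z, 0) hz, hinv, ← M.rep_eq_base hφc a z hz]

theorem Mirror.IsFourierMukai.add {φc ψc : CForm n Xc} {φ ψ : Form n X} (hφc : φc ∈ M.invForms)
    (hψc : ψc ∈ M.invForms) (h : M.IsFourierMukai φc φ) (h' : M.IsFourierMukai ψc ψ) :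
    M.IsFourierMukai (φc + ψc) (φ + ψ) := by
  rw [M.isFourierMukai_iff hφc] at h
  rw [M.isFourierMukai_iff hψc] at h'
  refine (M.isFourierMukai_iff (add_mem hφc hψc) _).2 fun a y hy => ?_
  rw [S.rep_add, M.rep_add]
  beta_reduce
  rw [h a y hy, h' a y hy, map_add]

theorem Mirror.IsFourierMukai.smul {φc : CForm n Xc} {φ : Form n X} (hφc : φc ∈ M.invForms)
    (h : M.IsFourierMukai φc φ) (c : ℂ) : M.IsFourierMukai (c • φc) (c • φ) := by
  rw [M.isFourierMukai_iff hφc] at h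
  refine (M.isFourierMukai_iff (Submodule.smul_mem _ c hφc) _).2 fun a y hy => ?_
  rw [S.rep_smul, M.rep_smul]
  beta_reduce
  rw [h a y hy, map_smul]

theorem Mirror.IsFourierMukai.right_unique {φc : CForm n Xc} {φ φ' : Form n X}
    (h : M.IsFourierMukai φc φ) (h' : M.IsFourierMukai φc φ') : φ = φ' :=
  S.form_ext fun a y hy => (h a y hy).trans (h' a y hy).symm

theorem Mirror.IsFourierMukai.left_unique {φc φc' : CForm n Xc} {φ : Form n X}
    (hφc : φc ∈ M.invForms) (hφc' : φc' ∈ M.invForms) (h : M.IsFourierMukai φc φ)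
    (h' : M.IsFourierMukai φc' φ) : φc = φc' := by
  rw [M.isFourierMukai_iff hφc] at h
  rw [M.isFourierMukai_iff hφc'] at h'
  refine M.form_ext fun a z hz => ?_
  rw [M.rep_eq_base hφc a z hz, M.rep_eq_base hφc' a z hz]
  exact ftLin_injective ((h a (imPart z, 0) hz).symm.trans (h' a (imPart z, 0) hz))

variable {φc : CForm n Xc} {φ : Form n X} {p q : ℕ}

theorem Mirror.IsFourierMukai.mem_invFormsPQ_iff (hφc : φc ∈ M.invForms) (hφ : φ ∈ S.invForms)
    (h : M.IsFourierMukai φc φ) (hp : p ≤ n) :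
    φc ∈ M.invFormsPQ p q ↔ φ ∈ S.invFormsPQ (n - p) q := by
  rw [M.isFourierMukai_iff hφc] at h
  refine ⟨fun hpq => ⟨hφ, fun a y hy => ?_⟩, fun hpq => ⟨hφc, fun a z hz => ?_⟩⟩
  · rw [h a y hy]
    exact ftLin_mem_bidegree hp (hpq.2 a _ (mem_dom_mkCpx M hy 0))
  · obtain ⟨c, hc, hinv⟩ := exists_ftInvLin_ftLin (n := n)
    have h1 := ftInvLin_mem_bidegree hp (hpq.2 a (imPart z, 0) hz)
    rw [h a (imPart z, 0) hz, hinv, ← M.rep_eq_base hφc a z hz] at h1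
    exact (Submodule.smul_mem_iff _ hc).1 h1

/-- The transform of `d` is a multiple of `d + d^Λ`, so cocycles correspond to cocycles. -/
theorem Mirror.IsFourierMukai.mem_bcKer_iff (hφc : φc ∈ M.invForms) (hφ : φ ∈ S.invForms)
    (h : M.IsFourierMukai φc φ) (hp : p ≤ n) :
    φc ∈ M.bcKer p q ↔ φ ∈ S.tyKer (n - p) q := by
  refine and_congr (h.mem_invFormsPQ_iff hφc hφ hp) (forall_congr' fun a => ?_)
  rw [M.isFourierMukai_iff hφc] at h
  have key : ∀ (z : Cpx n) (y : Dar n), y ∈ S.dom a → imPart z = y.1 →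
      ftLin (dCLoc (M.rep a φc) z) = ((-1) ^ n * (Complex.I / 2)) •
        (dLoc (S.rep a φ) y + dLamLoc (S.rep a φ) y) := fun z y hy hzy =>
    ftLin_dCLoc (S.chart a).open_target (M.smoothOn_base hφc a) (M.rep_eq_base hφc a) (h a) hy hzy
  have hc : ((-1 : ℂ) ^ n * (Complex.I / 2)) ≠ 0 :=
    mul_ne_zero (pow_ne_zero _ (by simp)) (div_ne_zero Complex.I_ne_zero two_ne_zero)
  refine ⟨fun h0 y hy => ?_, fun h0 z hz => ftLin_injective ?_⟩
  · have h1 := key (mkCpx y.1 0) y hy (imPart_mkCpx _ _)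
    rw [h0 _ (mem_dom_mkCpx M hy 0), map_zero] at h1
    exact (smul_eq_zero.1 h1.symm).resolve_left hc
  · rw [key z (imPart z, 0) hz rfl, h0 (imPart z, 0) hz, smul_zero, map_zero]

/-- The transform of `∂ ∂̄` is a multiple of `d d^Λ`, so coboundaries correspond to coboundaries. -/
theorem Mirror.IsFourierMukai.mem_bcIm_iff (hφc : φc ∈ M.invForms) (hφ : φ ∈ S.invForms)
    (h : M.IsFourierMukai φc φ) (hp : p ≤ n) :
    φc ∈ M.bcIm p q ↔ φ ∈ S.tyIm (n - p) q := by
  refine and_congr (h.mem_invFormsPQ_iff hφc hφ hp) ?_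
  rw [M.isFourierMukai_iff hφc] at h
  have key : ∀ ψc ∈ M.invForms, ∀ ψ, M.IsFourierMukai ψc ψ →
      ∀ a (z : Cpx n) (y : Dar n), y ∈ S.dom a → imPart z = y.1 →
        ftLin (delLoc (delbarLoc (M.rep a ψc)) z) =
          (1 / 4 : ℂ) • dLoc (dLamLoc (S.rep a ψ)) y := fun ψc hψc ψ hψ a z y hy hzy =>
    ftLin_delLoc_delbarLoc (S.chart a).open_target (M.smoothOn_base hψc a) (M.rep_eq_base hψc a)
      ((M.isFourierMukai_iff hψc ψ).1 hψ a) hy hzy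
  constructor
  · rintro ⟨ψc, hψc, hi⟩
    obtain ⟨ψ, hψ, hft⟩ := M.exists_isFourierMukai hψc
    refine ⟨(1 / 4 : ℂ) • ψ, Submodule.smul_mem _ _ hψ, fun a y hy => ?_⟩
    rw [S.rep_smul, dLoc_dLamLoc_smul (S.isOpen_dom a) (hψ a).1 _ hy,
      ← key ψc hψc ψ hft a (mkCpx y.1 0) y hy (imPart_mkCpx _ _), h a y hy,
      hi a _ (mem_dom_mkCpx M hy 0)]
  · rintro ⟨ψ, hψ, hi⟩
    obtain ⟨ψc, hψc, hft⟩ := M.exists_isFourierMukai_preimage hψ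
    refine ⟨(4 : ℂ) • ψc, Submodule.smul_mem _ _ hψc, fun a z hz => ftLin_injective ?_⟩
    rw [M.rep_smul, delLoc_delbarLoc_smul (M.isOpen_dom a) (hψc a).1 _ hz, map_smul,
      key ψc hψc ψ hft a z (imPart z, 0) hz rfl, ← hi a (imPart z, 0) hz, M.rep_eq_base hφc a z hz,
      ← h a (imPart z, 0) hz, smul_smul]
    norm_num

/-- The Fourier-Mukai transform as an isomorphism between the spaces of cocycles. -/
theorem Mirror.exists_kerEquiv (M : Mirror S Xc) (q : ℕ) (hp : p ≤ n) :
    ∃ E : M.bcKer p q ≃ₗ[ℂ] S.tyKer (n - p) q,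
      ∀ φc : M.bcKer p q, M.IsFourierMukai (φc : CForm n Xc) (E φc : Form n X) := by
  have hinv : ∀ φc : M.bcKer p q, (φc : CForm n Xc) ∈ M.invForms := fun φc => φc.2.1.1
  have hex : ∀ φc : M.bcKer p q, ∃ φ : S.tyKer (n - p) q,
      M.IsFourierMukai (φc : CForm n Xc) (φ : Form n X) := fun φc => by
    obtain ⟨φ, hφ, h⟩ := M.exists_isFourierMukai (hinv φc)
    exact ⟨⟨φ, (h.mem_bcKer_iff (hinv φc) hφ hp).1 φc.2⟩, h⟩
  choose T hT using hex
  let L : M.bcKer p q →ₗ[ℂ] S.tyKer (n - p) q :=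
    { toFun := T
      map_add' := fun φc ψc => Subtype.ext <|
        (hT (φc + ψc)).right_unique ((hT φc).add (hinv φc) (hinv ψc) (hT ψc))
      map_smul' := fun c φc => Subtype.ext <|
        (hT (c • φc)).right_unique ((hT φc).smul (hinv φc) c) }
  have hL : Function.Bijective L := by
    refine ⟨fun φc ψc h => Subtype.ext ?_, fun φ => ?_⟩
    · have h1 := hT φc
      rw [show T φc = T ψc from h] at h1
      exact h1.left_unique (hinv φc) (hinv ψc) (hT ψc)
    · obtain ⟨φc, hφc, h⟩ := M.exists_isFourierMukai_preimage φ.2.1.1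
      exact ⟨⟨φc, (h.mem_bcKer_iff hφc φ.2.1.1 hp).2 φ.2⟩, Subtype.ext ((hT _).right_unique h)⟩
  exact ⟨LinearEquiv.ofBijective L hL, hT⟩

theorem Mirror.exists_isFourierMukaiInv_kerEquiv (E : M.bcKer p q ≃ₗ[ℂ] S.tyKer (n - p) q)
    (hE : ∀ φc : M.bcKer p q, M.IsFourierMukai (φc : CForm n Xc) (E φc : Form n X)) :
    ∃ c : ℂ, c ≠ 0 ∧ ∀ φ : S.tyKer (n - p) q,
      M.IsFourierMukaiInv (φ : Form n X) ((c • E.symm φ : M.bcKer p q) : CForm n Xc) := by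
  refine M.exists_isFourierMukaiInv_smul.imp fun c hc => ⟨hc.1, fun φ => ?_⟩
  have h := hE (E.symm φ)
  rw [E.apply_symm_apply] at h
  exact hc.2 _ (E.symm φ).2.1.1 _ φ.2.1.1 h

/-- The transform on cocycles identifies the coboundaries of the two complexes. -/
theorem Mirror.exists_cocycleEquiv (M : Mirror S Xc) (q : ℕ) (hp : p ≤ n) :
    ∃ E : M.bcKer p q ≃ₗ[ℂ] S.tyKer (n - p) q,
      (∀ φc, φc ∈ (M.bcIm p q).submoduleOf (M.bcKer p q) ↔
        E φc ∈ (S.tyIm (n - p) q).submoduleOf (S.tyKer (n - p) q)) ∧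
      (∀ φc : M.bcKer p q, M.IsFourierMukai (φc : CForm n Xc) (E φc : Form n X)) ∧
      ∃ c : ℂ, c ≠ 0 ∧ ∀ φ : S.tyKer (n - p) q,
        M.IsFourierMukaiInv (φ : Form n X) ((c • E.symm φ : M.bcKer p q) : CForm n Xc) :=
  (M.exists_kerEquiv q hp).imp fun E hE =>
    ⟨fun φc => (hE φc).mem_bcIm_iff φc.2.1.1 (E φc).2.1.1 hp, hE,
      Mirror.exists_isFourierMukaiInv_kerEquiv E hE⟩

/-- A linear equivalence of cocycles that identifies the coboundaries induces isomorphisms of the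
quotients in both directions.  The relations `P` and `Q` stand for transforms given on cocycles by
a multiple of the inverse equivalence and by the equivalence itself. -/
theorem exists_quotientEquiv {V W : Type*} [AddCommGroup V] [Module ℂ V] [AddCommGroup W]
    [Module ℂ W] (I : Submodule ℂ V) (J : Submodule ℂ W) {P : W → V → Prop} {Q : V → W → Prop}
    (h : ∃ E : V ≃ₗ[ℂ] W, (∀ v, v ∈ I ↔ E v ∈ J) ∧ (∀ v, Q v (E v)) ∧
      ∃ c : ℂ, c ≠ 0 ∧ ∀ w, P w (c • E.symm w)) :
    (∃ e : (W ⧸ J) ≃ₗ[ℂ] (V ⧸ I), ∀ w, ∃ v, P w v ∧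
      e (Submodule.Quotient.mk w) = Submodule.Quotient.mk v) ∧
    ∃ e : (V ⧸ I) ≃ₗ[ℂ] (W ⧸ J), ∀ v, ∃ w, Q v w ∧
      e (Submodule.Quotient.mk v) = Submodule.Quotient.mk w := by
  obtain ⟨E, hIJ, hQ, c, hc, hP⟩ := h
  have hmap : I.map (E : V →ₗ[ℂ] W) = J := by
    ext w
    obtain ⟨v, rfl⟩ := E.surjective w
    refine Iff.trans ⟨?_, fun h' => ⟨v, h', rfl⟩⟩ (hIJ v)
    rintro ⟨u, hu, huv⟩
    rwa [← E.injective huv]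
  exact ⟨⟨(Submodule.Quotient.equiv I J E hmap).symm ≪≫ₗ LinearEquiv.smulOfNeZero ℂ _ c hc,
    fun w => ⟨_, hP w, rfl⟩⟩, Submodule.Quotient.equiv I J E hmap, fun v => ⟨_, hQ v, rfl⟩⟩

end Comparison

end SemiFlat

end

theorem mainTheorem3 {n : ℕ} {ι B X Xc : Type*}
    [TopologicalSpace B] [TopologicalSpace X] [ChartedSpace (SemiFlat.Dar n) X]
    [IsManifold 𝓘(ℝ, SemiFlat.Dar n) ∞ X]
    (σ : ∀ x : X, TangentSpace 𝓘(ℝ, SemiFlat.Dar n) x →ₗ[ℝ]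
      TangentSpace 𝓘(ℝ, SemiFlat.Dar n) x →ₗ[ℝ] ℝ)
    (S : SemiFlat.TorusBundle n ι B X σ)
    [TopologicalSpace Xc] [ChartedSpace (SemiFlat.Cpx n) Xc]
    [IsManifold 𝓘(ℂ, SemiFlat.Cpx n) ω Xc]
    (M : SemiFlat.Mirror S Xc) (p q : ℕ) (hp : p ≤ n) :
    (∃ e : S.TsengYau (n - p) q ≃ₗ[ℂ] M.BottChern p q,
      ∀ φ : S.tyKer (n - p) q, ∃ φc : M.bcKer p q,
        M.IsFourierMukaiInv (φ : SemiFlat.Form n X) (φc : SemiFlat.CForm n Xc) ∧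
          e (Submodule.Quotient.mk φ) = Submodule.Quotient.mk φc) ∧
    (∃ e : M.BottChern p q ≃ₗ[ℂ] S.TsengYau (n - p) q,
      ∀ φc : M.bcKer p q, ∃ φ : S.tyKer (n - p) q,
        M.IsFourierMukai (φc : SemiFlat.CForm n Xc) (φ : SemiFlat.Form n X) ∧
          e (Submodule.Quotient.mk φc) = Submodule.Quotient.mk φ) :=
  SemiFlat.exists_quotientEquiv _ _ (M.exists_cocycleEquiv q hp)
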